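/- Let $n$ be a cardinal with $1\le n\le\aleph_0$, let $\mathcal H_n$ be a complex Hilbert space with orthonormal basis $(e_i)_{1\le i\le n}$ (with $(e_i)_{i\ge1}$ if $n=\aleph_0$), and let $\mathcal F^2=\bigoplus_{k\ge 0}\mathcal H_n^{\otimes k}$ be its full Fock space, with left creation operators $S_i\psi=e_i\otimes\psi$. Let $\mathcal A_n\subset B(\mathcal F^2)$ be the norm-closed algebra generated by the $S_i$ and the identity, and let $F^\infty$ be the closure of $\mathcal A_n$ in the weak operator topology. Let $J$ be a two-sided ideal of $F^\infty$ that is closed in the $w^*$-topology of $B(\mathcal F^2)$ (the dual of the trace class operators). Let $\mathcal M_J$ be the closed linear span of $\{f\psi: f\in J,\ \psi\in\mathcal F^2\}$, let $\mathcal N_J=\mathcal F^2\ominus\mathcal M_J$, and let $P_{\mathcal N_J}$ be the orthogonal projection onto $\mathcal N_J$. For a Hilbert space $\mathcal H$, a set $I$ of cardinality $\gamma$ and a linear subspace $\mathcal U\subset B(\mathcal H)$, let $M_\gamma(\mathcal U)$ be the space of those bounded operators $[u_{\alpha\beta}]_{\alpha,\beta\in I}$ on the Hilbert direct sum $\bigoplus_{I}\mathcal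 H$ whose matrix entries $u_{\alpha\beta}$ all belong to $\mathcal U$, with the operator norm. (1) For every cardinal $\gamma$, the map $$\Phi: M_\gamma(F^\infty)/M_\gamma(J)\to M_\gamma(B(\mathcal N_J)),\qquad \Phi\big([f_{\alpha\beta}]+M_\gamma(J)\big)=\big[P_{\mathcal N_J}f_{\alpha\beta}|_{\mathcal N_J}\big],$$ is a well-defined linear isometry, where the domain carries the quotient norm. (2) The map $f+J\mapsto P_{\mathcal N_J}f|_{\mathcal N_J}$ is a well-defined unital algebra homomorphism $F^\infty/J\to B(\mathcal N_J)$, and it is completely isometric: for every $k$ and every matrix $[x_{ij}]\in M_k(F^\infty/J)$, the norm in $M_k(B(\mathcal N_J))=B(\mathcal N_J^{\,k})$ of the image of $[x_{ij}]$ equals the norm of $[x_{ij}]$ in the quotient operator space structure $M_k(F^\infty/J)=M_k(F^\infty)/M_k(J)$, that is, $\inf\{\|[f_{ij}]\|_{M_k(F^\infty)}: f_{ij}+J=x_{ij}\text{ for all } i,j\}$. -/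

import Mathlib

open scoped InnerProductSpace Topology

noncomputable section

namespace NCToeplitz

section Hilbert

variable {H : Type*} [NormedAddCommGroup H] [InnerProductSpace ℂ H]

/-- The `w*`-topology of `B(H)` as the dual of the trace class: the coarsest topology making
`A ↦ tr (T A) = ∑ₖ ⟨A xₖ, yₖ⟩` continuous for every trace class operator
`T = ∑ₖ ⟨·, yₖ⟩ xₖ`, where `(xₖ)` and `(yₖ)` run over the square summable sequences in `H`. -/
abbrev weakStarTopology (H : Type*) [NormedAddCommGroup H] [InnerProductSpace ℂ H] :
    TopologicalSpace (H →L[ℂ] H) :=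
  ⨅ (x : lp (fun _ : ℕ => H) 2) (y : lp (fun _ : ℕ => H) 2),
    TopologicalSpace.induced (fun A : H →L[ℂ] H => ∑' k, ⟪y k, A (x k)⟫_ℂ) inferInstance

/-- The closure of an algebra of operators in the weak operator topology. -/
def wotClosure (A : Subalgebra ℂ (H →L[ℂ] H)) : Subalgebra ℂ (H →L[ℂ] H) where
  carrier := {T | ContinuousLinearMapWOT.ofCLM T ∈
    closure (ContinuousLinearMapWOT.ofCLM '' (A : Set (H →L[ℂ] H)))}
  algebraMap_mem' c := subset_closure ⟨_, A.algebraMap_mem c, rfl⟩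
  add_mem' {S T} hS hT := by
    refine map_mem_closure₂ (f := fun a b => a + b) continuous_add hS hT ?_
    rintro _ ⟨a, ha, rfl⟩ _ ⟨b, hb, rfl⟩
    exact ⟨a + b, A.add_mem ha hb, rfl⟩
  mul_mem' {S T} hS hT := by
    have h1 : ∀ a ∈ A, ContinuousLinearMapWOT.ofCLM (a * T) ∈
        closure (ContinuousLinearMapWOT.ofCLM '' (A : Set (H →L[ℂ] H))) := by
      intro a ha
      refine map_mem_closure (f := fun B => (ContinuousLinearMapWOT.ofCLM a).comp B)
        (ContinuousLinearMapWOT.continuous_postcomp (ContinuousLinearMapWOT.ofCLM a)) hT ?_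
      rintro _ ⟨b, hb, rfl⟩
      exact ⟨a * b, A.mul_mem ha hb, rfl⟩
    rw [Set.mem_ofPred_eq, ← closure_closure]
    refine map_mem_closure (f := fun B => B.comp (ContinuousLinearMapWOT.ofCLM T))
      (ContinuousLinearMapWOT.continuous_precomp (ContinuousLinearMapWOT.ofCLM T)) hS ?_
    rintro _ ⟨a, ha, rfl⟩
    exact h1 a ha

/-- The compression `P_N T|_N` of an operator to a subspace. -/
def compression (N : Submodule ℂ H) [N.HasOrthogonalProjection] (T : H →L[ℂ] H) : N →L[ℂ] N :=
  N.orthogonalProjectionOnto ∘L T ∘L N.subtypeL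

/-- The Hilbert direct sum of copies of `H` indexed by `I`. -/
abbrev HilbertSum (I : Type*) (H : Type*) [NormedAddCommGroup H] : Type _ :=
  lp (fun _ : I => H) 2

open Classical in
/-- The entry `X_{αβ} ∈ B(H)` of an operator `X` on `⊕_I H`. -/
def entry {I : Type*} (X : HilbertSum I H →L[ℂ] HilbertSum I H) (α β : I) : H →L[ℂ] H :=
  lp.evalCLM ℂ (fun _ : I => H) 2 α ∘L X ∘L
    lp.singleContinuousLinearMap ℂ (fun _ : I => H) 2 β

/-- `M_γ(U)`, where `γ` is the cardinality of `I`: the bounded operators on `⊕_I H` whose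
matrix entries all belong to `U`. -/
def matrixSpace (I : Type*) (U : Submodule ℂ (H →L[ℂ] H)) :
    Submodule ℂ (HilbertSum I H →L[ℂ] HilbertSum I H) where
  carrier := {X | ∀ α β, entry X α β ∈ U}
  zero_mem' α β := by
    have : entry (0 : HilbertSum I H →L[ℂ] HilbertSum I H) α β = 0 := by
      ext; simp [entry]
    rw [this]; exact U.zero_mem
  add_mem' {X Y} hX hY α β := by
    have : entry (X + Y) α β = entry X α β + entry Y α β := by
      ext; simp [entry]
    rw [this]; exact U.add_mem (hX α β) (hY α β)
  smul_mem' c X hX α β := by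
    have : entry (c • X) α β = c • entry X α β := by
      ext; simp [entry]
    rw [this]; exact U.smul_mem c (hX α β)

/-- The operator on `⊕_I H` (with `I` finite) with a given matrix of operators on `H`. -/
def ofMatrix {I : Type*} [Fintype I] [DecidableEq I] (a : Matrix I I (H →L[ℂ] H)) :
    HilbertSum I H →L[ℂ] HilbertSum I H :=
  ∑ α, ∑ β, lp.singleContinuousLinearMap ℂ (fun _ : I => H) 2 α ∘L a α β ∘L
    lp.evalCLM ℂ (fun _ : I => H) 2 β

end Hilbert

section Fock

/-- The full Fock space `⊕_k H_n^{⊗k}` of the Hilbert space `H_n` with orthonormal basis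
`(e_i)_{i : ι}`, in the coordinates of its orthonormal basis of elementary tensors
`e_α = e_{i₁} ⊗ ⋯ ⊗ e_{i_k}`, `α = g_{i₁} ⋯ g_{i_k}` a word in the free monoid on `ι`
(the empty word being the vacuum vector). -/
abbrev Fock (ι : Type*) : Type _ := lp (fun _ : FreeMonoid ι => ℂ) 2

variable {ι : Type*}

theorem of_mul_injective (i : ι) :
    Function.Injective (fun α : FreeMonoid ι => FreeMonoid.of i * α) :=
  mul_right_injective (FreeMonoid.of i)

theorem norm_extend (i : ι) (f : FreeMonoid ι → ℂ) :
    (fun α => ‖Function.extend (fun α => FreeMonoid.of i * α) f 0 α‖ ^ (2 : ENNReal).toReal) =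
      Function.extend (fun α => FreeMonoid.of i * α)
        (fun α => ‖f α‖ ^ (2 : ENNReal).toReal) 0 := by
  funext α
  by_cases h : ∃ β, FreeMonoid.of i * β = α
  · obtain ⟨β, rfl⟩ := h
    rw [(of_mul_injective i).extend_apply, (of_mul_injective i).extend_apply]
  · rw [Function.extend_apply' _ _ _ h, Function.extend_apply' _ _ _ h]
    simp

/-- The left creation operator `S_i ψ = e_i ⊗ ψ`: the coefficient of `S_i ψ` at `g_i α` is the
coefficient of `ψ` at `α`, and its coefficients at all other words vanish. -/
def creation (i : ι) : Fock ι →L[ℂ] Fock ι :=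
  LinearIsometry.toContinuousLinearMap
    { toFun := fun ψ => ⟨Function.extend (fun α => FreeMonoid.of i * α) ψ 0, by
        refine memℓp_gen ?_
        rw [norm_extend]
        exact ((hasSum_extend_zero (of_mul_injective i)).2
          (lp.hasSum_norm (by norm_num) ψ)).summable⟩
      map_add' := fun φ ψ => by
        ext α
        by_cases h : ∃ β, FreeMonoid.of i * β = α
        · obtain ⟨β, rfl⟩ := h
          simp only [lp.coeFn_add, Pi.add_apply]
          rw [(of_mul_injective i).extend_apply, (of_mul_injective i).extend_apply,
            (of_mul_injective i).extend_apply, Pi.add_apply]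
        · simp only [lp.coeFn_add, Pi.add_apply]
          rw [Function.extend_apply' _ _ _ h, Function.extend_apply' _ _ _ h,
            Function.extend_apply' _ _ _ h]
          simp
      map_smul' := fun c ψ => by
        ext α
        by_cases h : ∃ β, FreeMonoid.of i * β = α
        · obtain ⟨β, rfl⟩ := h
          simp [(of_mul_injective i).extend_apply]
        · simp [Function.extend_apply' _ _ _ h]
      norm_map' := fun ψ => by
        have h2 : 0 < (2 : ENNReal).toReal := by norm_num
        rw [lp.norm_eq_tsum_rpow h2, lp.norm_eq_tsum_rpow h2]
        congr 1
        refine Eq.trans (congrArg tsum (norm_extend i ψ)) ?_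
        exact ((hasSum_extend_zero (of_mul_injective i)).2 (lp.hasSum_norm h2 ψ)).tsum_eq.trans
          (lp.hasSum_norm h2 ψ).tsum_eq.symm }

/-- The noncommutative disc algebra `𝒜_n`: the norm closed algebra generated by the left
creation operators and the identity. -/
def discAlgebra (ι : Type*) : Subalgebra ℂ (Fock ι →L[ℂ] Fock ι) :=
  (Algebra.adjoin ℂ (Set.range (creation (ι := ι)))).topologicalClosure

/-- The noncommutative analytic Toeplitz algebra `F^∞`: the closure of `𝒜_n` in the weak
operator topology. -/
def toeplitzAlgebra (ι : Type*) : Subalgebra ℂ (Fock ι →L[ℂ] Fock ι) :=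
  wotClosure (discAlgebra ι)

/-- A left (in particular, a two-sided) ideal of `F^∞` as a subspace of `B(ℱ²)`. -/
def idealSpace (J : Ideal (toeplitzAlgebra ι)) : Submodule ℂ (Fock ι →L[ℂ] Fock ι) :=
  (J.restrictScalars ℂ).map (toeplitzAlgebra ι).val.toLinearMap

/-- `ℳ_J`, the closed linear span of the vectors `φ ⊗ ψ = φ(S₁, …, S_n) ψ` with `φ ∈ J` and
`ψ ∈ ℱ²`. -/
def idealRange (J : Ideal (toeplitzAlgebra ι)) : Submodule ℂ (Fock ι) :=
  (Submodule.span ℂ {v | ∃ f ∈ idealSpace J, ∃ ψ : Fock ι, v = f ψ}).topologicalClosure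

/-- `𝒩_J = ℱ² ⊖ ℳ_J`. -/
abbrev coRange (J : Ideal (toeplitzAlgebra ι)) : Submodule ℂ (Fock ι) :=
  (idealRange J)ᗮ

/-- `M_γ(J)` as a subspace of `M_γ(F^∞)`. -/
abbrev matrixIdeal (I : Type*) (J : Ideal (toeplitzAlgebra ι)) :
    Submodule ℂ (matrixSpace I (Subalgebra.toSubmodule (toeplitzAlgebra ι))) :=
  (matrixSpace I (idealSpace J)).submoduleOf
    (matrixSpace I (Subalgebra.toSubmodule (toeplitzAlgebra ι)))

/-- The norm of `M_k(F^∞/J)` in the quotient operator space structure,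
`M_k(F^∞/J) = M_k(F^∞)/M_k(J)`: the infimum of the norms of the matrices over `F^∞` that
represent a given matrix over `F^∞/J`. -/
def quotientMatrixNorm (J : Ideal (toeplitzAlgebra ι)) {k : ℕ}
    (x : Matrix (Fin k) (Fin k) (toeplitzAlgebra ι ⧸ J)) : ℝ :=
  sInf {r | ∃ f : Matrix (Fin k) (Fin k) (toeplitzAlgebra ι),
    (∀ i j, Submodule.Quotient.mk (f i j) = x i j) ∧
      r = ‖ofMatrix fun i j => (f i j : Fock ι →L[ℂ] Fock ι)‖}

end Fock

end NCToeplitz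

end

open NCToeplitz

noncomputable section

namespace NCToeplitz

/-! ### Hilbert sums, amplifications and matrix entries -/

section SquareSummable

/-! Compression to `𝒩_J` is contractive and kills `J`, so the compressed norm is at most the
quotient norm. The reverse inequality asks for a representative of each coset of `M_γ(J)` whose norm
is at most that of its compression. Two facts supply it, and show that the infimum is attained.

The first is commutant lifting, `IsBackwardShift.exists_extension`. The adjoints `B_i` of the right
creation operators leave `𝒩_J` invariant, and the adjoint of the compression of a matrix over `F^∞`
commutes with their restrictions to `⊕_I 𝒩_J`. It extends with no larger norm to an operator `Z`
commuting with the amplified `B_i`, and `Z*` is the representative. The extension of a contraction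
`C` is built as a transfer function: with `D` the defect operator of `C`, the map `((D B_i h)_i, ε
h) ↦ (D h, ε C h)` preserves norms, so it is implemented by a contraction `U`. Feeding `U` into two
fixed point equations along the pure shift gives first an extension `E` of `D`, then `Z` with `‖Z
h‖² + ‖E h‖² ≤ ‖h‖²`.

The second is `mem_of_range_le`: a suitable `w*`-closed space `W` of operators commuting with the
right creation operators contains every such operator whose range lies in the closed span of the
ranges of `W`. A separating functional is `A ↦ ⟨y, A^(∞) x⟩`. The vector `x` lies in the image of an
isometry `V` intertwining the left creation operators (`exists_intertwiner`), and `V` also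
intertwines each `A` with `A^(∞)`, so the functional sees only ranges.

For `W = F^∞` this identifies `F^∞` with the commutant of the right creation operators, hence the
entries of `Z*` belong to `F^∞`. For `W = J` it shows that the difference from the original matrix,
whose entries have range in `ℳ_J`, has entries in `J`. -/

theorem memℓp_two_iff {I H : Type*} [NormedAddCommGroup H] {f : I → H} :
    Memℓp f 2 ↔ Summable fun i => ‖f i‖ ^ 2 := by
  rw [memℓp_gen_iff (by norm_num)]
  simp

theorem hasSum_norm_sq {I H : Type*} [NormedAddCommGroup H] (x : HilbertSum I H) :
    HasSum (fun i => ‖x i‖ ^ 2) (‖x‖ ^ 2) := by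
  have := lp.hasSum_norm (p := 2) (by norm_num) x
  simpa using this

variable {I : Type*} {H H' : Type*}
  [NormedAddCommGroup H] [InnerProductSpace ℂ H] [NormedAddCommGroup H'] [InnerProductSpace ℂ H']

@[simp]
theorem evalCLM_apply (x : HilbertSum I H) (i : I) :
    lp.evalCLM ℂ (fun _ : I => H) 2 i x = x i := rfl

/-- The column operator `h ↦ (T_i h)_i` of a square summable family of operators. -/
def column (T : I → H →L[ℂ] H') (C : ℝ)
    (hs : ∀ h, Summable fun i => ‖T i h‖ ^ 2)
    (hT : ∀ h, ∑' i, ‖T i h‖ ^ 2 ≤ C ^ 2 * ‖h‖ ^ 2) : H →L[ℂ] HilbertSum I H' :=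
  LinearMap.mkContinuous
    { toFun := fun h => ⟨fun i => T i h, memℓp_two_iff.2 (hs h)⟩
      map_add' := fun x y => by ext i; exact map_add (T i) x y
      map_smul' := fun c x => by ext i; exact map_smul (T i) c x } |C| fun h => by
    refine abs_le_of_sq_le_sq' ?_ (by positivity) |>.2
    rw [← (hasSum_norm_sq _).tsum_eq, mul_pow, sq_abs]
    exact hT h

variable (I) in
/-- The amplification `⊕_I T` of an operator. -/
def amp (T : H →L[ℂ] H') : HilbertSum I H →L[ℂ] HilbertSum I H' :=
  lp.mapCLM 2 (fun _ => T) (norm_nonneg T) fun _ => le_rfl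

@[simp]
theorem amp_apply (T : H →L[ℂ] H') (x : HilbertSum I H) (i : I) : amp I T x i = T (x i) := rfl

theorem norm_amp_le (T : H →L[ℂ] H') : ‖amp I T‖ ≤ ‖T‖ := lp.norm_mapCLM_le _ _ _ _

theorem norm_amp_sq (T : H →L[ℂ] H') (x : HilbertSum I H) :
    HasSum (fun i => ‖T (x i)‖ ^ 2) (‖amp I T x‖ ^ 2) := hasSum_norm_sq (amp I T x)

theorem adjoint_amp [CompleteSpace H] [CompleteSpace H'] (T : H →L[ℂ] H') :
    ContinuousLinearMap.adjoint (amp I T) = amp I (ContinuousLinearMap.adjoint T) := by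
  symm
  rw [ContinuousLinearMap.eq_adjoint_iff]
  intro x y
  simp [lp.inner_eq_tsum, ContinuousLinearMap.adjoint_inner_left]

open Classical in
theorem clm_ext_single {f g : HilbertSum I H →L[ℂ] H'}
    (h : ∀ i v, f (lp.single 2 i v) = g (lp.single 2 i v)) : f = g := by
  refine lp.ext_continuousLinearMap (by norm_num) fun i => ?_
  ext v
  exact h i v

theorem entry_apply [inst : DecidableEq I] (X : HilbertSum I H →L[ℂ] HilbertSum I H) (α β : I)
    (v : H) : entry X α β v = X (lp.single 2 β v) α := by
  obtain rfl : inst = fun a b => Classical.propDecidable (a = b) := Subsingleton.elim _ _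
  rfl

theorem entry_injective : Function.Injective
    (entry : (HilbertSum I H →L[ℂ] HilbertSum I H) → I → I → H →L[ℂ] H) := by
  classical
  intro X Y h
  refine clm_ext_single fun i v => ?_
  ext : 1
  funext b
  have := congrArg (fun e => e b i v) h
  simp only [entry_apply] at this
  convert this

theorem entry_sub (X Y : HilbertSum I H →L[ℂ] HilbertSum I H) (α β : I) :
    entry (X - Y) α β = entry X α β - entry Y α β := by
  ext v; simp [entry]

open Classical in
theorem amp_single (T : H →L[ℂ] H') (i : I) (v : H) :
    amp I T (lp.single 2 i v) = lp.single 2 i (T v) := by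
  ext j
  rw [amp_apply, lp.single_apply, lp.single_apply]
  by_cases h : j = i
  · subst h; simp
  · simp [h]

/-- Entries of `A X B`, with `A`, `B` amplifications. -/
theorem entry_amp_comp {K : Type*} [NormedAddCommGroup K] [InnerProductSpace ℂ K]
    (A : H →L[ℂ] K) (B : K →L[ℂ] H)
    (X : HilbertSum I H →L[ℂ] HilbertSum I H) (α β : I) :
    entry (amp I A ∘L X ∘L amp I B) α β = A ∘L entry X α β ∘L B := by
  classical
  ext v
  simp only [entry_apply, ContinuousLinearMap.comp_apply, amp_apply, amp_single]

/-- Reduces commutation on `⊕_I H` to commutation of single entries, so that facts about `F^∞` apply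
to operator matrices of any size. -/
theorem commute_amp_iff (X : HilbertSum I H →L[ℂ] HilbertSum I H) (T : H →L[ℂ] H) :
    X ∘L amp I T = amp I T ∘L X ↔ ∀ α β, entry X α β ∘L T = T ∘L entry X α β := by
  classical
  constructor
  · intro h α β
    ext v
    have := congrArg (fun Y => Y (lp.single 2 β v) α) h
    simpa only [entry_apply, ContinuousLinearMap.comp_apply, amp_apply, amp_single] using this
  · intro h
    apply entry_injective
    funext α β
    ext v
    have := congrArg (fun Y => Y v) (h α β)
    simpa only [entry_apply, ContinuousLinearMap.comp_apply, amp_apply, amp_single] using this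

/-- Interchange of the order of summation in an array of nonnegative numbers. -/
theorem hasSum_tsum_swap {J : Type*} {f : I → J → ℝ} {g : I → ℝ} (hf : ∀ a b, 0 ≤ f a b)
    (h : ∀ a, HasSum (f a) (g a)) (hg : Summable g) :
    (∀ b, Summable fun a => f a b) ∧ HasSum (fun b => ∑' a, f a b) (∑' a, g a) := by
  have hp : Summable (Function.uncurry f) := by
    refine (summable_prod_of_nonneg fun p => hf p.1 p.2).2 ⟨fun a => (h a).summable, ?_⟩
    refine hg.congr fun a => ?_
    exact (h a).tsum_eq.symm
  have hp' : Summable (fun p : J × I => f p.2 p.1) := hp.prod_symm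
  refine ⟨fun b => hp'.prod_factor b, ?_⟩
  have h1 : ∑' a, g a = ∑' b, ∑' a, f a b := by
    rw [hp.tsum_comm']
    · exact tsum_congr fun a => (h a).tsum_eq.symm
    · exact fun a => (h a).summable
    · exact fun b => hp'.prod_factor b
  rw [h1]
  exact hp'.prod.hasSum

end SquareSummable

/-! ### Commutant lifting for pure backward shifts -/

section Lifting

open Filter

/-- A pointwise norm inequality `‖q x‖ ≤ ‖p x‖` is implemented by a contraction `U` with
`U p = q`. -/
theorem exists_contraction_comp_eq {E F G : Type*} [NormedAddCommGroup E] [InnerProductSpace ℂ E]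
    [NormedAddCommGroup F] [InnerProductSpace ℂ F] [CompleteSpace F]
    [NormedAddCommGroup G] [InnerProductSpace ℂ G] [CompleteSpace G]
    (p : E →L[ℂ] F) (q : E →L[ℂ] G) (h : ∀ x, ‖q x‖ ≤ ‖p x‖) :
    ∃ U : F →L[ℂ] G, (∀ y, ‖U y‖ ≤ ‖y‖) ∧ ∀ x, U (p x) = q x := by
  set K := (LinearMap.range p.toLinearMap).topologicalClosure with hK
  have hpK : ∀ x, p x ∈ K := fun x =>
    Submodule.le_topologicalClosure _ (LinearMap.mem_range_self p.toLinearMap x)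
  have : CompleteSpace K := (Submodule.isClosed_topologicalClosure _).completeSpace_coe
  let e : E →ₗ[ℂ] K := p.toLinearMap.codRestrict K hpK
  have hd : DenseRange e := by
    intro y
    rw [Metric.mem_closure_iff]
    intro r hr
    have hy : (y : F) ∈ closure (LinearMap.range p.toLinearMap : Set F) := y.2
    obtain ⟨_, ⟨x, rfl⟩, hx⟩ := Metric.mem_closure_iff.1 hy r hr
    exact ⟨e x, ⟨x, rfl⟩, hx⟩
  have hn : ∀ x, ‖q.toLinearMap x‖ ≤ 1 * ‖e x‖ := fun x => by simpa using! h x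
  -- The map `p x ↦ q x` is well defined and contractive on the range of `p`; extend it to the
  -- closure by density and by zero on the orthogonal complement.
  refine ⟨q.toLinearMap.extendOfNorm e ∘L K.orthogonalProjectionOnto, fun y => ?_, fun x => ?_⟩
  · refine (LinearMap.norm_extendOfNorm_apply_le hd 1 hn _).trans ?_
    rw [one_mul]
    exact K.norm_orthogonalProjectionOnto_apply_le y
  · have h1 : K.orthogonalProjectionOnto (p x) = e x :=
      Submodule.orthogonalProjectionOnto_mem_subspace_eq_self (⟨p x, hpK x⟩ : K)
    rw [ContinuousLinearMap.comp_apply, h1, LinearMap.extendOfNorm_eq hd ⟨1, hn⟩]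
    rfl

/-- A contraction has a defect operator. -/
theorem exists_defect {N : Type*} [NormedAddCommGroup N] [InnerProductSpace ℂ N] [CompleteSpace N]
    (C : N →L[ℂ] N) (hC : ∀ h, ‖C h‖ ≤ ‖h‖) :
    ∃ D : N →L[ℂ] N, ∀ h, ‖D h‖ ^ 2 = ‖h‖ ^ 2 - ‖C h‖ ^ 2 := by
  set Q : N →L[ℂ] N := 1 - star C * C with hQ
  have hre : ∀ h, ⟪Q h, h⟫_ℂ = ((‖h‖ ^ 2 - ‖C h‖ ^ 2 : ℝ) : ℂ) := by
    intro h
    have : ⟪(star C * C) h, h⟫_ℂ = ⟪C h, C h⟫_ℂ := by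
      rw [ContinuousLinearMap.star_eq_adjoint, mul_apply_eq_comp,
        ContinuousLinearMap.adjoint_inner_left]
    rw [hQ, sub_apply, inner_sub_left, this, one_apply_eq_self,
      inner_self_eq_norm_sq_to_K, inner_self_eq_norm_sq_to_K]
    push_cast
    rfl
  have hpos : 0 ≤ Q := by
    rw [ContinuousLinearMap.nonneg_iff_isPositive, ContinuousLinearMap.isPositive_iff_complex]
    intro h
    rw [hre]
    refine ⟨Complex.ext (Complex.ofReal_re _) (Complex.ofReal_im _), ?_⟩
    exact (sub_nonneg.2 (pow_le_pow_left₀ (norm_nonneg _) (hC h) 2)).trans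
      (Complex.ofReal_re _).ge
  refine ⟨CFC.sqrt Q, fun h => ?_⟩
  have hsa : star (CFC.sqrt Q) = CFC.sqrt Q := (IsSelfAdjoint.of_nonneg (CFC.sqrt_nonneg Q)).star_eq
  have h1 : ⟪CFC.sqrt Q h, CFC.sqrt Q h⟫_ℂ = ⟪Q h, h⟫_ℂ := by
    conv_rhs => rw [← CFC.sqrt_mul_sqrt_self Q hpos]
    rw [mul_apply_eq_comp]
    conv_rhs => rw [← hsa, ContinuousLinearMap.star_eq_adjoint,
      ContinuousLinearMap.adjoint_inner_left]
    rw [← ContinuousLinearMap.star_eq_adjoint, hsa]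
  rw [hre, inner_self_eq_norm_sq_to_K] at h1
  refine Complex.ofReal_injective (Eq.trans ?_ h1)
  push_cast
  rfl

variable {ι : Type*} {H K G N : Type*}
  [NormedAddCommGroup H] [InnerProductSpace ℂ H] [NormedAddCommGroup K] [InnerProductSpace ℂ K]
  [NormedAddCommGroup G] [InnerProductSpace ℂ G]

/-- The operators `B i` are the adjoints of a family of pure isometries with pairwise orthogonal
ranges, and `ε` is the map onto the wandering subspace `K`; `t m h` is the squared norm of the
part of `h` of degree at least `m`. -/
structure IsBackwardShift (B : ι → H →L[ℂ] H) (ε : H →L[ℂ] K) (t : ℕ → H → ℝ) : Prop where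
  hasSum_norm : ∀ h, HasSum (fun i => ‖B i h‖ ^ 2) (‖h‖ ^ 2 - ‖ε h‖ ^ 2)
  tail_zero : ∀ h, t 0 h = ‖h‖ ^ 2
  tail_succ : ∀ m h, HasSum (fun i => t m (B i h)) (t (m + 1) h)
  tail_tendsto : ∀ h, Tendsto (fun m => t m h) atTop (𝓝 0)
  surjective : ∃ (Θ : HilbertSum ι H →L[ℂ] H) (δ : K →L[ℂ] H), ∀ g k,
    (∀ i, B i (Θ g + δ k) = g i) ∧ ε (Θ g + δ k) = k

namespace IsBackwardShift

variable {B : ι → H →L[ℂ] H} {ε : H →L[ℂ] K} {t : ℕ → H → ℝ}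

/-- The column `h ↦ (B i h)_i`. -/
def col (hS : IsBackwardShift B ε t) : H →L[ℂ] HilbertSum ι H :=
  column B 1 (fun h => (hS.hasSum_norm h).summable) fun h => by
    rw [(hS.hasSum_norm h).tsum_eq]
    nlinarith [sq_nonneg ‖ε h‖]

@[simp]
theorem col_apply (hS : IsBackwardShift B ε t) (h : H) (i : ι) : hS.col h i = B i h := rfl

theorem norm_col_sq (hS : IsBackwardShift B ε t) (h : H) :
    ‖hS.col h‖ ^ 2 = ‖h‖ ^ 2 - ‖ε h‖ ^ 2 :=
  (hasSum_norm_sq (hS.col h)).unique (hS.hasSum_norm h)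

theorem eq_zero (hS : IsBackwardShift B ε t) {h : H} (hB : ∀ i, B i h = 0) (hε : ε h = 0) :
    h = 0 := by
  have h1 := hS.norm_col_sq h
  have h2 : hS.col h = 0 := by ext i; simpa using hB i
  rw [h2, hε] at h1
  simpa using h1.symm

/-- Solution of the fixed point equation `E = A (⊕ E) (B i)_i + c`. -/
theorem exists_fixedPoint [CompleteSpace H] [CompleteSpace G]
    (hS : IsBackwardShift B ε t) (A : HilbertSum ι G →L[ℂ] G)
    (hA : ∀ g, ‖A g‖ ≤ ‖g‖) (c : H →L[ℂ] G) (u : H → ℝ) (hu0 : ∀ h, 0 ≤ u h)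
    (hu1 : ∀ h, u h ≤ ‖h‖ ^ 2)
    (hstep : ∀ E : H →L[ℂ] G, (∀ h, ‖E h‖ ^ 2 ≤ u h) →
      ∀ h, ‖A (amp ι E (hS.col h)) + c h‖ ^ 2 ≤ u h) :
    ∃ E : H →L[ℂ] G, (∀ h, E h = A (amp ι E (hS.col h)) + c h) ∧ ∀ h, ‖E h‖ ^ 2 ≤ u h := by
  let step : (H →L[ℂ] G) → H →L[ℂ] G := fun E => A ∘L amp ι E ∘L hS.col + c
  -- Picard iteration from zero. The map need not be a strict contraction; convergence comes from
  -- purity of the shift.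
  let E : ℕ → H →L[ℂ] G := fun m => step^[m] 0
  have hE0 : E 0 = 0 := rfl
  have hEs : ∀ m h, E (m + 1) h = A (amp ι (E m) (hS.col h)) + c h := fun m h => by
    simp only [E, Function.iterate_succ_apply']
    rfl
  have hEu : ∀ m h, ‖E m h‖ ^ 2 ≤ u h := by
    intro m
    induction m with
    | zero => intro h; rw [hE0]; simpa using hu0 h
    | succ m ih => intro h; rw [hEs]; exact hstep (E m) ih h
  have ampsub : ∀ (X Y : H →L[ℂ] G) (v : HilbertSum ι H),
      amp ι X v - amp ι Y v = amp ι (X - Y) v := fun X Y v => by ext i; simp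
  -- Each iteration passes the difference through the contraction `A` and one application of the `B
  -- i`, so after `m` of them only the part of degree at least `m` is left.
  have hcauchy : ∀ k m h, ‖E (m + k) h - E m h‖ ^ 2 ≤ t m h := by
    intro k m
    induction m with
    | zero =>
      intro h
      rw [hE0, hS.tail_zero]
      simpa using (hEu k h).trans (hu1 h)
    | succ m ih =>
      intro h
      rw [show m + 1 + k = (m + k) + 1 by ring, hEs, hEs, add_sub_add_right_eq_sub, ← map_sub,
        ampsub]
      refine (pow_le_pow_left₀ (norm_nonneg _) (hA _) 2).trans ?_
      refine hasSum_le (fun i => ?_) (norm_amp_sq (E (m + k) - E m) (hS.col h)) (hS.tail_succ m h)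
      simpa using ih (B i h)
  have htnn : ∀ m h, 0 ≤ t m h := fun m h => (sq_nonneg _).trans (hcauchy 0 m h)
  have hcs : ∀ h, CauchySeq fun m => E m h := by
    intro h
    have hk : ∀ m k, dist (E (m + k) h) (E m h) ≤ Real.sqrt (t m h) := fun m k => by
      rw [dist_eq_norm]
      exact Real.le_sqrt_of_sq_le (hcauchy k m h)
    refine cauchySeq_of_le_tendsto_0 (fun m => 2 * Real.sqrt (t m h)) (fun n m M hn hm => ?_) ?_
    · obtain ⟨a, rfl⟩ := Nat.exists_eq_add_of_le hn
      obtain ⟨b, rfl⟩ := Nat.exists_eq_add_of_le hm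
      have := dist_triangle_right (E (M + a) h) (E (M + b) h) (E M h)
      linarith [hk M a, hk M b]
    · have := ((Real.continuous_sqrt.tendsto 0).comp (hS.tail_tendsto h)).const_mul 2
      simpa using this
  choose e he using fun h => cauchySeq_tendsto_of_complete (hcs h)
  -- Boundedness of the pointwise limit is Banach–Steinhaus.
  let F : H →L[ℂ] G := continuousLinearMapOfTendsto (l := atTop) (g := fun m => E m) (f := e)
    (tendsto_pi_nhds.2 he)
  have hF : ∀ h, Tendsto (fun m => E m h) atTop (𝓝 (F h)) := he
  have hFE : ∀ m h, ‖F h - E m h‖ ^ 2 ≤ t m h := fun m h => by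
    have h1 : Tendsto (fun k => ‖E (m + k) h - E m h‖ ^ 2) atTop (𝓝 (‖F h - E m h‖ ^ 2)) := by
      have := (hF h).comp (tendsto_add_atTop_nat m)
      refine Tendsto.pow (Tendsto.norm (Tendsto.sub_const ?_ _)) 2
      simpa [Function.comp_def, add_comm] using this
    exact le_of_tendsto' h1 fun k => hcauchy k m h
  refine ⟨F, fun h => ?_, fun h => ?_⟩
  · have h1 : Tendsto (fun m => amp ι (E m) (hS.col h)) atTop (𝓝 (amp ι F (hS.col h))) := by
      rw [tendsto_iff_norm_sub_tendsto_zero]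
      have h2 : ∀ m, ‖amp ι (E m) (hS.col h) - amp ι F (hS.col h)‖ ≤ Real.sqrt (t (m + 1) h) := by
        intro m
        rw [norm_sub_rev, ampsub]
        refine Real.le_sqrt_of_sq_le ?_
        refine hasSum_le (fun i => ?_) (norm_amp_sq (F - E m) (hS.col h)) (hS.tail_succ m h)
        simpa using hFE m (B i h)
      refine squeeze_zero (fun _ => norm_nonneg _) h2 ?_
      have := (Real.continuous_sqrt.tendsto 0).comp
        ((hS.tail_tendsto h).comp (tendsto_add_atTop_nat 1))
      simpa [Function.comp_def] using this
    have h3 : Tendsto (fun m => E (m + 1) h) atTop (𝓝 (A (amp ι F (hS.col h)) + c h)) := by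
      simp only [hEs]
      exact ((A.continuous.tendsto _).comp h1).add_const _
    exact tendsto_nhds_unique ((hF h).comp (tendsto_add_atTop_nat 1)) h3
  · exact le_of_tendsto' ((hF h).norm.pow 2) fun m => hEu m h

/-- Uniqueness of solutions of the fixed point equation, on a subspace invariant under `B`. -/
theorem fixedPoint_unique [NormedAddCommGroup N] (hS : IsBackwardShift B ε t)
    (A : HilbertSum ι G →L[ℂ] G)
    (hA : ∀ g, ‖A g‖ ≤ ‖g‖) (c : H →L[ℂ] G) (E : H →L[ℂ] G)
    (hE : ∀ h, E h = A (amp ι E (hS.col h)) + c h) (hE1 : ∀ h, ‖E h‖ ≤ ‖h‖)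
    (j : N → H) (hj : ∀ h, ‖j h‖ = ‖h‖) (b : ι → N → N) (hb : ∀ i h, j (b i h) = B i (j h))
    (e : N → G) (he : ∀ h, ‖e h‖ ≤ ‖h‖)
    (hfix : ∀ h, ∃ g : HilbertSum ι G, (∀ i, g i = e (b i h)) ∧ e h = A g + c (j h)) (h : N) :
    e h = E (j h) := by
  -- The factor 4 is the square of the crude bound `2‖h‖` for two contractive solutions; the shift
  -- then drives the tail to zero.
  have key : ∀ m h, ‖e h - E (j h)‖ ^ 2 ≤ 4 * t m (j h) := by
    intro m
    induction m with
    | zero =>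
      intro h
      have h1 : ‖e h - E (j h)‖ ≤ 2 * ‖j h‖ := by
        have := norm_sub_le (e h) (E (j h))
        linarith [he h, hj h, hE1 (j h)]
      rw [hS.tail_zero]
      nlinarith [pow_le_pow_left₀ (norm_nonneg _) h1 2]
    | succ m ih =>
      intro h
      obtain ⟨g, hg, hgA⟩ := hfix h
      rw [hgA, hE, add_sub_add_right_eq_sub, ← map_sub]
      refine (pow_le_pow_left₀ (norm_nonneg _) (hA _) 2).trans ?_
      refine hasSum_le (fun i => ?_) (hasSum_norm_sq (g - amp ι E (hS.col (j h))))
        ((hS.tail_succ m (j h)).mul_left 4)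
      have := ih (b i h)
      rw [hb] at this
      simpa [hg] using this
  have h0 : Tendsto (fun m => 4 * t m (j h)) atTop (𝓝 0) := by
    simpa using (hS.tail_tendsto (j h)).const_mul 4
  have h1 : ‖e h - E (j h)‖ ^ 2 ≤ 0 := ge_of_tendsto' h0 fun m => key m h
  have h2 : ‖e h - E (j h)‖ = 0 := by
    have := sq_nonneg ‖e h - E (j h)‖
    exact pow_eq_zero_iff (two_ne_zero) |>.1 (le_antisymm h1 this)
  exact sub_eq_zero.1 (norm_eq_zero.1 h2)

/-- A contraction `C` on a subspace invariant under the backward shifts that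
commutes with their restrictions extends to a contraction commuting with the backward shifts. -/
theorem exists_extension_of_contraction [CompleteSpace H] [CompleteSpace K] [NormedAddCommGroup N]
    [InnerProductSpace ℂ N] [CompleteSpace N] (hS : IsBackwardShift B ε t)
    (j : N →L[ℂ] H) (hj : ∀ h, ‖j h‖ = ‖h‖) (b : ι → N →L[ℂ] N)
    (hb : ∀ i h, j (b i h) = B i (j h)) (C : N →L[ℂ] N) (hC : ∀ h, ‖C h‖ ≤ ‖h‖)
    (hcomm : ∀ i h, C (b i h) = b i (C h)) :
    ∃ Z : H →L[ℂ] H, (∀ h, ‖Z h‖ ≤ ‖h‖) ∧ (∀ i h, Z (B i h) = B i (Z h)) ∧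
      ∀ h, Z (j h) = j (C h) := by
  obtain ⟨D, hD⟩ := exists_defect C hC
  have hD1 : ∀ h, ‖D h‖ ≤ ‖h‖ := fun h => by
    refine abs_le_of_sq_le_sq' ?_ (norm_nonneg _) |>.2
    rw [hD]
    nlinarith [sq_nonneg ‖C h‖]
  have hsumb : ∀ h, HasSum (fun i => ‖b i h‖ ^ 2) (‖h‖ ^ 2 - ‖ε (j h)‖ ^ 2) := fun h => by
    have := hS.hasSum_norm (j h)
    simpa only [← hb, hj] using this
  -- Since `C` commutes with `b i`, the term is `‖b i h‖² - ‖b i (C h)‖²`, and the norm identity of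
  -- the shift is used at both `h` and `C h`.
  have hsumD : ∀ h, HasSum (fun i => ‖(D ∘L b i) h‖ ^ 2)
      (‖h‖ ^ 2 - ‖ε (j h)‖ ^ 2 - (‖C h‖ ^ 2 - ‖ε (j (C h))‖ ^ 2)) := fun h => by
    have := (hsumb h).sub (hsumb (C h))
    simpa only [ContinuousLinearMap.comp_apply, hD, hcomm] using this
  let d : N →L[ℂ] HilbertSum ι N := column (fun i => D ∘L b i) 1 (fun h => (hsumD h).summable)
    fun h => by
      rw [(hsumD h).tsum_eq]
      have h1 := (hsumb (C h)).nonneg fun i => sq_nonneg _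
      nlinarith [sq_nonneg ‖ε (j h)‖]
  have hd : ∀ h, ‖d h‖ ^ 2 =
      ‖h‖ ^ 2 - ‖ε (j h)‖ ^ 2 - (‖C h‖ ^ 2 - ‖ε (j (C h))‖ ^ 2) := fun h =>
    (hasSum_norm_sq (d h)).unique (hsumD h)
  let pr1 := (WithLp.prodContinuousLinearEquiv 2 ℂ (HilbertSum ι N) K).symm.toContinuousLinearMap
  let pr2 := (WithLp.prodContinuousLinearEquiv 2 ℂ N K).symm.toContinuousLinearMap
  -- The two columns have equal norms: `‖d h‖² + ‖ε h‖² = ‖D h‖² + ‖ε C h‖²` is the preceding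
  -- identity rearranged.
  obtain ⟨U, hU, hUp⟩ := exists_contraction_comp_eq
    (pr1 ∘L d.prod (ε ∘L j)) (pr2 ∘L D.prod (ε ∘L j ∘L C)) fun h => by
      refine abs_le_of_sq_le_sq' (le_of_eq ?_) (norm_nonneg _) |>.2
      rw [WithLp.prod_norm_sq_eq_of_L2, WithLp.prod_norm_sq_eq_of_L2]
      change ‖D h‖ ^ 2 + ‖ε (j (C h))‖ ^ 2 = ‖d h‖ ^ 2 + ‖ε (j h)‖ ^ 2
      rw [hd, hD]
      ring
  have hUp1 : ∀ h, (U (WithLp.toLp 2 (d h, ε (j h)))).fst = D h := fun h =>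
    congrArg WithLp.fst (hUp h)
  have hUp2 : ∀ h, (U (WithLp.toLp 2 (d h, ε (j h)))).snd = ε (j (C h)) := fun h =>
    congrArg WithLp.snd (hUp h)
  have hU2 : ∀ g k, ‖(U (WithLp.toLp 2 (g, k))).fst‖ ^ 2 + ‖(U (WithLp.toLp 2 (g, k))).snd‖ ^ 2 ≤
      ‖g‖ ^ 2 + ‖k‖ ^ 2 := fun g k => by
    have := pow_le_pow_left₀ (norm_nonneg _) (hU (WithLp.toLp 2 (g, k))) 2
    rwa [WithLp.prod_norm_sq_eq_of_L2, WithLp.prod_norm_sq_eq_of_L2] at this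
  -- extension of the defect operator
  let A₁ : HilbertSum ι N →L[ℂ] N :=
    WithLp.fstL 2 ℂ N K ∘L U ∘L pr1 ∘L ContinuousLinearMap.inl ℂ _ _
  let c₁ : H →L[ℂ] N :=
    WithLp.fstL 2 ℂ N K ∘L U ∘L pr1 ∘L ContinuousLinearMap.inr ℂ _ _ ∘L ε
  have hAc₁ : ∀ g h, A₁ g + c₁ h = (U (WithLp.toLp 2 (g, ε h))).fst := fun g h => by
    have : WithLp.toLp 2 (g, ε h) =
        pr1 (ContinuousLinearMap.inl ℂ _ _ g) + pr1 (ContinuousLinearMap.inr ℂ _ _ (ε h)) := by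
      rw [← map_add]
      change _ = WithLp.toLp 2 _
      simp
    rw [this, map_add]
    rfl
  have hA₁ : ∀ g, ‖A₁ g‖ ≤ ‖g‖ := fun g => by
    have h1 := hAc₁ g 0
    rw [map_zero, map_zero, add_zero] at h1
    have h2 := hU2 g 0
    rw [← h1] at h2
    refine abs_le_of_sq_le_sq' ?_ (norm_nonneg _) |>.2
    simp only [norm_zero] at h2
    nlinarith [sq_nonneg ‖(U (WithLp.toLp 2 (g, 0))).snd‖]
  obtain ⟨E, hE, hEn⟩ := hS.exists_fixedPoint A₁ hA₁ c₁ (fun h => ‖h‖ ^ 2) (fun h => sq_nonneg _)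
    (fun h => le_rfl) fun E hE h => by
      rw [hAc₁]
      have h1 : ‖amp ι E (hS.col h)‖ ^ 2 ≤ ‖hS.col h‖ ^ 2 :=
        hasSum_le (fun i => hE _) (norm_amp_sq E _) (hasSum_norm_sq _)
      rw [hS.norm_col_sq] at h1
      nlinarith [hU2 (amp ι E (hS.col h)) (ε h),
        sq_nonneg ‖(U (WithLp.toLp 2 (amp ι E (hS.col h), ε h))).snd‖]
  have hE1 : ∀ h, ‖E h‖ ≤ ‖h‖ := fun h =>
    abs_le_of_sq_le_sq' (hEn h) (norm_nonneg _) |>.2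
  have hEj : ∀ h, D h = E (j h) :=
    hS.fixedPoint_unique A₁ hA₁ c₁ E hE hE1 j hj (fun i => b i) hb D hD1 fun h =>
      ⟨d h, fun i => rfl, by rw [hAc₁, hUp1]⟩
  -- The second component of `U` prescribes what the wandering part `ε (Z h)` has to be; on the
  -- range of `j` it is `ε (j (C h))`.
  let ζ : H →L[ℂ] K :=
    WithLp.sndL 2 ℂ N K ∘L U ∘L pr1 ∘L (amp ι E ∘L hS.col).prod ε
  have hζ : ∀ h, ζ h = (U (WithLp.toLp 2 (amp ι E (hS.col h), ε h))).snd := fun h => rfl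
  have hζn : ∀ h, ‖E h‖ ^ 2 + ‖ζ h‖ ^ 2 ≤ ‖amp ι E (hS.col h)‖ ^ 2 + ‖ε h‖ ^ 2 := fun h => by
    rw [hE, hAc₁, hζ]
    exact hU2 _ _
  -- The map `h ↦ ((B i h)_i, ε h)` is unitary, and `Θ g + δ k` is its inverse.
  obtain ⟨Θ, δ, hΘ⟩ := hS.surjective
  have hΘn : ∀ g k, ‖Θ g + δ k‖ ^ 2 = ‖g‖ ^ 2 + ‖k‖ ^ 2 := fun g k => by
    have h1 := hS.norm_col_sq (Θ g + δ k)
    have h2 : hS.col (Θ g + δ k) = g := by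
      ext i
      exact (hΘ g k).1 i
    rw [h2, (hΘ g k).2] at h1
    linarith
  have hΘ1 : ∀ g, ‖Θ g‖ ≤ ‖g‖ := fun g => by
    refine abs_le_of_sq_le_sq' (le_of_eq ?_) (norm_nonneg _) |>.2
    simpa using hΘn g 0
  -- The equation says exactly that `B i (Z h) = Z (B i h)` and `ε (Z h) = ζ h`. The sharper bound
  -- `‖h‖² - ‖E h‖²` is needed to absorb `‖ζ h‖²` through the contractivity of `U`.
  obtain ⟨Z, hZ, hZn⟩ := hS.exists_fixedPoint Θ hΘ1 (δ ∘L ζ) (fun h => ‖h‖ ^ 2 - ‖E h‖ ^ 2)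
    (fun h => sub_nonneg.2 (hEn h)) (fun h => sub_le_self _ (sq_nonneg _)) fun Z hZ h => by
      rw [ContinuousLinearMap.comp_apply, hΘn]
      have h1 : ‖amp ι Z (hS.col h)‖ ^ 2 ≤ ‖hS.col h‖ ^ 2 - ‖amp ι E (hS.col h)‖ ^ 2 :=
        hasSum_le (fun i => hZ _) (norm_amp_sq Z _)
          ((hasSum_norm_sq (hS.col h)).sub (norm_amp_sq E _))
      rw [hS.norm_col_sq] at h1
      linarith [hζn h]
  have hZ1 : ∀ h, ‖Z h‖ ≤ ‖h‖ := fun h =>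
    abs_le_of_sq_le_sq' ((hZn h).trans (sub_le_self _ (sq_nonneg _))) (norm_nonneg _) |>.2
  refine ⟨Z, hZ1, fun i h => ?_, fun h => ?_⟩
  · rw [hZ h, ContinuousLinearMap.comp_apply, (hΘ _ _).1]
    rfl
  · symm
    refine hS.fixedPoint_unique Θ hΘ1 (δ ∘L ζ) Z hZ hZ1 j hj (fun i => b i) hb
      (fun h => j (C h)) (fun h => by rw [hj]; exact hC h) (fun h => ?_) h
    -- `j ∘ C` solves the equation for `Z` along `j`, so uniqueness applies.
    refine ⟨hS.col (j (C h)), fun i => ?_, ?_⟩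
    · rw [hcomm, hb]
      rfl
    · have h1 : ζ (j h) = ε (j (C h)) := by
        rw [hζ, ← hUp2]
        congr 4
        ext i
        simp only [amp_apply, col_apply, ← hb, ← hEj]
        rfl
      rw [ContinuousLinearMap.comp_apply, h1]
      refine sub_eq_zero.1 (hS.eq_zero (fun i => ?_) ?_)
      · rw [map_sub, (hΘ _ _).1]
        simp
      · rw [map_sub, (hΘ _ _).2]
        simp

/-- Commutant lifting: an operator `C` on a subspace invariant under the backward shifts that
commutes with their restrictions extends, without increase of norm, to an operator commuting with
the backward shifts. -/
theorem exists_extension [CompleteSpace H] [CompleteSpace K] [NormedAddCommGroup N]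
    [InnerProductSpace ℂ N] [CompleteSpace N] (hS : IsBackwardShift B ε t)
    (j : N →L[ℂ] H) (hj : ∀ h, ‖j h‖ = ‖h‖) (b : ι → N →L[ℂ] N)
    (hb : ∀ i h, j (b i h) = B i (j h)) (C : N →L[ℂ] N)
    (hcomm : ∀ i h, C (b i h) = b i (C h)) :
    ∃ Z : H →L[ℂ] H, ‖Z‖ ≤ ‖C‖ ∧ (∀ i h, Z (B i h) = B i (Z h)) ∧ ∀ h, Z (j h) = j (C h) := by
  by_cases hC0 : C = 0
  · exact ⟨0, by simp, fun i h => by simp, fun h => by simp [hC0]⟩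
  · have hc : (‖C‖ : ℂ) ≠ 0 := by simpa using hC0
    obtain ⟨Z, hZn, hZB, hZj⟩ := hS.exists_extension_of_contraction j hj b hb
      ((‖C‖ : ℂ)⁻¹ • C) (fun h => by
        rw [smul_apply, norm_smul, norm_inv, Complex.norm_real, norm_norm,
          inv_mul_le_iff₀ (norm_pos_iff.2 hC0)]
        exact C.le_opNorm h)
      (fun i h => by
        rw [smul_apply, smul_apply, hcomm, map_smul])
    refine ⟨(‖C‖ : ℂ) • Z, ?_, fun i h => ?_, fun h => ?_⟩
    · have h1 : ‖Z‖ ≤ 1 := Z.opNorm_le_bound zero_le_one fun h => by simpa using hZn h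
      rw [norm_smul, Complex.norm_real, norm_norm]
      exact mul_le_of_le_one_right (norm_nonneg _) h1
    · rw [smul_apply, smul_apply, hZB, map_smul]
    · rw [smul_apply, hZj, smul_apply, map_smul, smul_inv_smul₀ hc]

end IsBackwardShift

end Lifting

/-! ### Creation and annihilation operators on the Fock space -/

section FockShift

open Filter ContinuousLinearMap

variable {ι : Type*}

theorem word_cases_left (w : FreeMonoid ι) : w = 1 ∨ ∃ i v, w = FreeMonoid.of i * v := by
  induction w using FreeMonoid.inductionOn' with
  | one => exact Or.inl rfl
  | of_mul i v _ => exact Or.inr ⟨i, v, rfl⟩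

theorem word_cases_right (w : FreeMonoid ι) : w = 1 ∨ ∃ v i, w = v * FreeMonoid.of i :=
  (List.eq_nil_or_concat w.toList).imp id fun ⟨v, i, h⟩ =>
    ⟨FreeMonoid.ofList v, i, h.trans List.concat_eq_append⟩

theorem mul_of_inj {v w : FreeMonoid ι} {i j : ι}
    (h : v * FreeMonoid.of i = w * FreeMonoid.of j) : v = w ∧ i = j := by
  have h1 : v.toList ++ [i] = w.toList ++ [j] := h
  obtain ⟨h2, h3⟩ := List.append_inj' h1 rfl
  exact ⟨h2, by simpa using h3⟩

theorem of_mul_inj {v w : FreeMonoid ι} {i j : ι}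
    (h : FreeMonoid.of i * v = FreeMonoid.of j * w) : i = j ∧ v = w := by
  have h1 : i :: v.toList = j :: w.toList := h
  exact List.cons.inj h1

theorem mul_of_ne_one (v : FreeMonoid ι) (i : ι) : v * FreeMonoid.of i ≠ 1 := fun h => by
  have := congrArg FreeMonoid.length h
  simp at this

theorem of_mul_ne_one (v : FreeMonoid ι) (i : ι) : FreeMonoid.of i * v ≠ 1 := fun h => by
  have := congrArg FreeMonoid.length h
  simp at this

theorem mul_of_injective (i : ι) : Function.Injective fun w : FreeMonoid ι => w * FreeMonoid.of i :=
  fun _ _ h => (mul_of_inj h).1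

/-- Summation over words according to their last letter. -/
theorem hasSum_last_letter {u : FreeMonoid ι → ℝ} {s : ℝ} (h : HasSum u s) :
    HasSum (fun i => ∑' w, u (w * FreeMonoid.of i)) (s - u 1) := by
  classical
  -- The empty word is the only one without a last letter; its term is removed.
  have hup : HasSum (Function.update u 1 0) (s - u 1) := by
    have := h.update 1 0
    rwa [zero_sub, neg_add_eq_sub] at this
  have hinj : Function.Injective fun p : ι × FreeMonoid ι => p.2 * FreeMonoid.of p.1 := by
    rintro ⟨i, v⟩ ⟨j, w⟩ hp
    obtain ⟨h1, h2⟩ := mul_of_inj hp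
    exact Prod.ext h2 h1
  have h2 : HasSum (fun p : ι × FreeMonoid ι => u (p.2 * FreeMonoid.of p.1)) (s - u 1) := by
    have h3 := (hinj.hasSum_iff (f := Function.update u 1 0) (a := s - u 1) ?_).2 hup
    · refine h3.congr_fun fun p => ?_
      rw [Function.comp_apply, Function.update_of_ne (mul_of_ne_one _ _)]
    · intro w hw
      rcases word_cases_right w with rfl | ⟨v, i, rfl⟩
      · simp
      · exact absurd ⟨(i, v), rfl⟩ hw
  exact h2.prod_fiberwise fun i => (h2.summable.prod_factor i).hasSum

open Classical in
/-- The orthonormal basis vector `e_w` of the Fock space. -/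
def basisVec (w : FreeMonoid ι) : Fock ι := lp.single 2 w (1 : ℂ)

theorem inner_basisVec (w : FreeMonoid ι) (ψ : Fock ι) : ⟪basisVec w, ψ⟫_ℂ = ψ w := by
  classical
  have h := lp.inner_single_left (𝕜 := ℂ) (G := fun _ : FreeMonoid ι => ℂ) w 1 ψ
  simp only [RCLike.inner_apply, map_one, mul_one] at h
  rw [← h, basisVec]

open Classical in
theorem basisVec_apply (w v : FreeMonoid ι) : basisVec w v = if v = w then (1 : ℂ) else 0 := by
  rw [basisVec, lp.single_apply, Pi.single_apply]

@[simp]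
theorem basisVec_self (w : FreeMonoid ι) : basisVec w w = (1 : ℂ) := by
  rw [basisVec_apply, if_pos rfl]

theorem basisVec_ne {w v : FreeMonoid ι} (h : v ≠ w) : basisVec w v = (0 : ℂ) := by
  rw [basisVec_apply, if_neg h]

theorem fock_clm_ext {X : Type*} [NormedAddCommGroup X] [InnerProductSpace ℂ X]
    {f g : Fock ι →L[ℂ] X} (h : ∀ w, f (basisVec w) = g (basisVec w)) : f = g := by
  classical
  refine clm_ext_single fun w c => ?_
  have hc : (lp.single 2 w c : Fock ι) = c • basisVec w := by
    rw [basisVec, ← lp.single_smul]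
    simp
  have := congrArg (fun x => c • x) (h w)
  simp only [← map_smul, ← hc] at this
  convert this

@[simp]
theorem creation_apply_of_mul (i : ι) (ψ : Fock ι) (w : FreeMonoid ι) :
    creation i ψ (FreeMonoid.of i * w) = ψ w :=
  (of_mul_injective i).extend_apply _ _ _

@[simp]
theorem creation_apply_one (i : ι) (ψ : Fock ι) : creation i ψ 1 = 0 := by
  refine Function.extend_apply' _ _ _ ?_
  rintro ⟨w, hw⟩
  exact of_mul_ne_one w i hw

theorem creation_apply_ne {i j : ι} (h : i ≠ j) (ψ : Fock ι) (w : FreeMonoid ι) :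
    creation i ψ (FreeMonoid.of j * w) = 0 := by
  refine Function.extend_apply' _ _ _ ?_
  rintro ⟨v, hv⟩
  exact h (of_mul_inj hv).1

theorem creation_basisVec (i : ι) (w : FreeMonoid ι) :
    creation i (basisVec w) = basisVec (FreeMonoid.of i * w) := by
  ext v
  rcases word_cases_left v with rfl | ⟨j, v, rfl⟩
  · rw [creation_apply_one, basisVec_ne (of_mul_ne_one w i).symm]
  · by_cases hij : i = j
    · subst hij
      rw [creation_apply_of_mul, basisVec_apply, basisVec_apply]
      congr 1
      exact propext ⟨fun h => by rw [h], fun h => (of_mul_inj h).2⟩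
    · rw [creation_apply_ne hij, basisVec_ne fun h => hij (of_mul_inj h).1.symm]

/-- The left annihilation operators. -/
abbrev annihilation (i : ι) : Fock ι →L[ℂ] Fock ι := adjoint (creation i)

theorem annihilation_apply (i : ι) (ψ : Fock ι) (w : FreeMonoid ι) :
    annihilation i ψ w = ψ (FreeMonoid.of i * w) := by
  rw [← inner_basisVec, adjoint_inner_right, creation_basisVec, inner_basisVec]

open Classical in
theorem annihilation_creation (i j : ι) (ψ : Fock ι) :
    annihilation i (creation j ψ) = if i = j then ψ else 0 := by
  ext w
  rw [annihilation_apply]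
  split_ifs with h
  · subst h
    rw [creation_apply_of_mul]
  · rw [creation_apply_ne (Ne.symm h)]
    rfl

theorem annihilation_vacuum (i : ι) : annihilation i (basisVec 1) = 0 := by
  ext w
  rw [annihilation_apply, basisVec_ne (of_mul_ne_one w i)]
  rfl

/-- The right annihilation operators: the coefficient of `B_i ψ` at `α` is that of `ψ` at
`α g_i`. -/
def rightAnnihilation (i : ι) : Fock ι →L[ℂ] Fock ι :=
  LinearMap.mkContinuous
    { toFun := fun ψ => ⟨fun w => ψ (w * FreeMonoid.of i), memℓp_two_iff.2
        ((hasSum_norm_sq ψ).summable.comp_injective (mul_of_injective i))⟩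
      map_add' := fun _ _ => rfl
      map_smul' := fun _ _ => rfl } 1 fun ψ => by
    rw [one_mul]
    refine abs_le_of_sq_le_sq' ?_ (norm_nonneg _) |>.2
    rw [← (hasSum_norm_sq _).tsum_eq, ← (hasSum_norm_sq ψ).tsum_eq]
    exact tsum_comp_le_tsum_of_inj (hasSum_norm_sq ψ).summable (fun _ => sq_nonneg _)
      (mul_of_injective i)

@[simp]
theorem rightAnnihilation_apply (i : ι) (ψ : Fock ι) (w : FreeMonoid ι) :
    rightAnnihilation i ψ w = ψ (w * FreeMonoid.of i) := rfl

/-- The right creation operators `R_i ψ = ψ ⊗ e_i`. -/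
def rightCreation (i : ι) : Fock ι →L[ℂ] Fock ι := adjoint (rightAnnihilation i)

theorem adjoint_rightCreation (i : ι) : adjoint (rightCreation i) = rightAnnihilation i :=
  adjoint_adjoint _

theorem rightCreation_basisVec (i : ι) (w : FreeMonoid ι) :
    rightCreation i (basisVec w) = basisVec (w * FreeMonoid.of i) := by
  refine ext_inner_right ℂ fun ψ => ?_
  rw [rightCreation, adjoint_inner_left, inner_basisVec, inner_basisVec, rightAnnihilation_apply]

theorem rightAnnihilation_basisVec_one (i : ι) : rightAnnihilation i (basisVec 1) = 0 := by
  ext w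
  rw [rightAnnihilation_apply, basisVec_ne (mul_of_ne_one w i)]
  rfl

open Classical in
theorem rightAnnihilation_basisVec_mul (i j : ι) (w : FreeMonoid ι) :
    rightAnnihilation i (basisVec (w * FreeMonoid.of j)) = if i = j then basisVec w else 0 := by
  ext v
  rw [rightAnnihilation_apply]
  split_ifs with h
  · subst h
    rw [basisVec_apply, basisVec_apply]
    congr 1
    exact propext ⟨fun h => (mul_of_inj h).1, fun h => by rw [h]⟩
  · rw [basisVec_ne fun h' => h (mul_of_inj h').2]
    rfl

theorem rightCreation_apply_one (i : ι) (ψ : Fock ι) : rightCreation i ψ 1 = 0 := by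
  rw [← inner_basisVec, rightCreation, adjoint_inner_right, rightAnnihilation_basisVec_one,
    inner_zero_left]

open Classical in
theorem rightCreation_apply_mul (i j : ι) (ψ : Fock ι) (w : FreeMonoid ι) :
    rightCreation i ψ (w * FreeMonoid.of j) = if i = j then ψ w else 0 := by
  rw [← inner_basisVec, rightCreation, adjoint_inner_right, rightAnnihilation_basisVec_mul]
  split_ifs
  · rw [inner_basisVec]
  · rw [inner_zero_left]

open Classical in
theorem rightAnnihilation_rightCreation (i j : ι) (ψ : Fock ι) :
    rightAnnihilation i (rightCreation j ψ) = if i = j then ψ else 0 := by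
  ext w
  rw [rightAnnihilation_apply, rightCreation_apply_mul]
  by_cases h : i = j
  · rw [if_pos h, if_pos h.symm]
  · rw [if_neg h, if_neg (Ne.symm h)]
    rfl

theorem creation_comp_rightCreation (i j : ι) :
    creation i ∘L rightCreation j = rightCreation j ∘L creation i := by
  refine fock_clm_ext fun w => ?_
  simp only [comp_apply, rightCreation_basisVec, creation_basisVec, mul_assoc]

/-- The vacuum must be excluded: `S_i* R_i` fixes it while `R_i S_i*` kills it. On longer words
deleting the first letter and appending a last one do not interfere. -/
theorem annihilation_rightCreation (i j : ι) {φ : Fock ι} (h : φ 1 = 0) :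
    annihilation i (rightCreation j φ) = rightCreation j (annihilation i φ) := by
  classical
  ext w
  rw [annihilation_apply]
  rcases word_cases_right w with rfl | ⟨w, k, rfl⟩
  · rw [rightCreation_apply_one, mul_one, ← one_mul (FreeMonoid.of i), rightCreation_apply_mul, h,
      ite_self]
  · rw [← mul_assoc, rightCreation_apply_mul, rightCreation_apply_mul, annihilation_apply]

/-- Vectors in the ranges of the right creation operators have no vacuum coefficient, and `T`
preserves these ranges, so only the vacuum part of `ψ` contributes. -/
theorem apply_one_of_commute_right {T : Fock ι →L[ℂ] Fock ι}
    (hT : ∀ i, T ∘L rightCreation i = rightCreation i ∘L T) (ψ : Fock ι) :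
    T ψ 1 = T (basisVec 1) 1 * ψ 1 := by
  have h : lp.evalCLM ℂ (fun _ : FreeMonoid ι => ℂ) 2 1 ∘L T =
      T (basisVec 1) 1 • lp.evalCLM ℂ (fun _ : FreeMonoid ι => ℂ) 2 1 := by
    refine fock_clm_ext fun w => ?_
    simp only [comp_apply, evalCLM_apply, smul_apply, smul_eq_mul]
    rcases word_cases_right w with rfl | ⟨w, i, rfl⟩
    · simp
    · rw [← rightCreation_basisVec, ← comp_apply, hT, comp_apply, rightCreation_apply_one,
        rightCreation_apply_one, mul_zero]
  exact congrArg (fun f => f ψ) h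

theorem apply_one_of_commute_left {G : Fock ι →L[ℂ] Fock ι}
    (hG : ∀ i, G ∘L creation i = creation i ∘L G) (ψ : Fock ι) :
    G ψ 1 = G (basisVec 1) 1 * ψ 1 := by
  have h : lp.evalCLM ℂ (fun _ : FreeMonoid ι => ℂ) 2 1 ∘L G =
      G (basisVec 1) 1 • lp.evalCLM ℂ (fun _ : FreeMonoid ι => ℂ) 2 1 := by
    refine fock_clm_ext fun w => ?_
    simp only [comp_apply, evalCLM_apply, smul_apply, smul_eq_mul]
    rcases word_cases_left w with rfl | ⟨i, w, rfl⟩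
    · simp
    · rw [← creation_basisVec, ← comp_apply, hG, comp_apply, creation_apply_one,
        creation_apply_one, mul_zero]
  exact congrArg (fun f => f ψ) h

/-- `G` commutes with `S_i* S_j`, hence with `S_i*` on the ranges of the creation operators; the
vacuum alone produces the correction term. -/
theorem annihilation_comp_of_commute {G : Fock ι →L[ℂ] Fock ι}
    (hG : ∀ i, G ∘L creation i = creation i ∘L G) (i : ι) (ψ : Fock ι) :
    annihilation i (G ψ) = G (annihilation i ψ) + ψ 1 • annihilation i (G (basisVec 1)) := by
  classical
  have h : annihilation i ∘L G = G ∘L annihilation i +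
      (lp.evalCLM ℂ (fun _ : FreeMonoid ι => ℂ) 2 1).smulRight
        (annihilation i (G (basisVec 1))) := by
    refine fock_clm_ext fun w => ?_
    simp only [comp_apply, add_apply, smulRight_apply, evalCLM_apply]
    rcases word_cases_left w with rfl | ⟨j, w, rfl⟩
    · simp [annihilation_vacuum]
    · rw [← creation_basisVec, ← comp_apply G, hG, comp_apply, creation_apply_one, zero_smul,
        add_zero, annihilation_creation, annihilation_creation]
      split_ifs <;> simp
  exact congrArg (fun f => f ψ) h

/-- Operators commuting with the left creation operators commute with operators commuting with
the right creation operators. -/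
theorem commute_of_commute_left_right {G : Fock ι →L[ℂ] Fock ι}
    (hG : ∀ i, G ∘L creation i = creation i ∘L G) {T : Fock ι →L[ℂ] Fock ι}
    (hT : ∀ i, T ∘L rightCreation i = rightCreation i ∘L T) (ψ : Fock ι) : T (G ψ) = G (T ψ) := by
  ext w
  induction w using FreeMonoid.inductionOn' generalizing T with
  | one =>
    rw [apply_one_of_commute_right hT, apply_one_of_commute_left hG ψ,
      apply_one_of_commute_left hG (T ψ), apply_one_of_commute_right hT ψ]
    ring
  | of_mul i w ih =>
    set a := T (basisVec 1) 1 with ha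
    -- Strip one letter from `T`: after subtracting its constant term, `S_i*` keeps it in the
    -- commutant of the right creation operators. This is why the induction generalizes over `T`.
    let T' : Fock ι →L[ℂ] Fock ι := annihilation i ∘L (T - a • ContinuousLinearMap.id ℂ _)
    have hT' : ∀ j, T' ∘L rightCreation j = rightCreation j ∘L T' := fun j => by
      ext1 φ
      have h0 : (T φ - a • φ) 1 = 0 := by
        change T φ 1 - a * φ 1 = 0
        rw [apply_one_of_commute_right hT, sub_self]
      have h1 : T (rightCreation j φ) = rightCreation j (T φ) := congrArg (fun f => f φ) (hT j)
      change annihilation i (T (rightCreation j φ) - a • rightCreation j φ) =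
        rightCreation j (annihilation i (T φ - a • φ))
      rw [h1, ← map_smul, ← map_sub, annihilation_rightCreation i j h0]
    have hT'a : ∀ φ, annihilation i (T φ) = T' φ + a • annihilation i φ := fun φ => by
      change _ = annihilation i (T φ - a • φ) + a • annihilation i φ
      rw [map_sub, map_smul, sub_add_cancel]
    have h2 : T (G ψ) (FreeMonoid.of i * w) = T' (G ψ) w + a * annihilation i (G ψ) w := by
      rw [← annihilation_apply, hT'a]
      rfl
    have h3 : G (T ψ) (FreeMonoid.of i * w) = G (T' ψ) w + a * annihilation i (G ψ) w := by
      rw [← annihilation_apply, annihilation_comp_of_commute hG, hT'a,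
        annihilation_comp_of_commute hG i ψ, apply_one_of_commute_right hT, map_add, map_smul]
      change G (T' ψ) w + a * G (annihilation i ψ) w + a * ψ 1 * annihilation i (G (basisVec 1)) w =
        G (T' ψ) w + a * (G (annihilation i ψ) w + ψ 1 * annihilation i (G (basisVec 1)) w)
      ring
    rw [h2, h3, ih hT']

/-- The squared norm of the part of `ψ` of degree at least `m`. -/
def tail (m : ℕ) (ψ : Fock ι) : ℝ := ∑' w, if m ≤ w.length then ‖ψ w‖ ^ 2 else 0

theorem hasSum_tail (m : ℕ) (ψ : Fock ι) :
    HasSum (fun w => if m ≤ w.length then ‖ψ w‖ ^ 2 else 0) (tail m ψ) := by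
  refine (Summable.of_nonneg_of_le (fun w => ?_) (fun w => ?_)
    (hasSum_norm_sq ψ).summable).hasSum
  · split_ifs <;> positivity
  · split_ifs
    · exact le_rfl
    · positivity

theorem tail_nonneg (m : ℕ) (ψ : Fock ι) : 0 ≤ tail m ψ :=
  (hasSum_tail m ψ).nonneg fun w => by split_ifs <;> positivity

theorem tail_le (m : ℕ) (ψ : Fock ι) : tail m ψ ≤ ‖ψ‖ ^ 2 := by
  refine hasSum_le (fun w => ?_) (hasSum_tail m ψ) (hasSum_norm_sq ψ)
  split_ifs
  · exact le_rfl
  · positivity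

theorem tail_zero (ψ : Fock ι) : tail 0 ψ = ‖ψ‖ ^ 2 := by
  simpa [tail] using (hasSum_norm_sq ψ).tsum_eq

/-- Sort words by last letter; the vacuum term vanishes because the threshold `m + 1` is positive.
-/
theorem hasSum_tail_succ (m : ℕ) (ψ : Fock ι) :
    HasSum (fun i => tail m (rightAnnihilation i ψ)) (tail (m + 1) ψ) := by
  have h := hasSum_last_letter (hasSum_tail (m + 1) ψ)
  simpa [tail] using h

theorem tendsto_tail (ψ : Fock ι) : Tendsto (fun m => tail m ψ) atTop (𝓝 0) := by
  have h := tendsto_tsum_of_dominated_convergence (𝓕 := atTop)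
    (f := fun (m : ℕ) w => if m ≤ w.length then ‖ψ w‖ ^ 2 else 0) (g := fun _ => 0)
    (hasSum_norm_sq ψ).summable (fun w => ?_) (Eventually.of_forall fun m w => ?_)
  · simpa [tail] using h
  · refine tendsto_const_nhds.congr' ?_
    filter_upwards [eventually_gt_atTop w.length] with m hm
    rw [if_neg (by omega)]
  · split_ifs
    · simp
    · simp

theorem hasSum_norm_rightAnnihilation (ψ : Fock ι) :
    HasSum (fun i => ‖rightAnnihilation i ψ‖ ^ 2) (‖ψ‖ ^ 2 - ‖ψ 1‖ ^ 2) := by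
  have h := hasSum_last_letter (hasSum_norm_sq ψ)
  refine h.congr_fun fun i => ?_
  exact (hasSum_norm_sq (rightAnnihilation i ψ)).tsum_eq.symm

variable (ι) in
/-- The coefficient at the vacuum vector. -/
def vacuumCoeff : Fock ι →L[ℂ] ℂ := lp.evalCLM ℂ (fun _ : FreeMonoid ι => ℂ) 2 1

theorem vacuumCoeff_apply (ψ : Fock ι) : vacuumCoeff ι ψ = ψ 1 := rfl

theorem adjoint_vacuumCoeff (c : ℂ) : adjoint (vacuumCoeff ι) c = c • basisVec 1 := by
  refine ext_inner_right ℂ fun ψ => ?_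
  rw [adjoint_inner_left, inner_smul_left, inner_basisVec, vacuumCoeff_apply, RCLike.inner_apply,
    mul_comm]

theorem hasSum_norm_amp_rightAnnihilation (I : Type*) (h : HilbertSum I (Fock ι)) :
    HasSum (fun i => ‖amp I (rightAnnihilation i) h‖ ^ 2)
      (‖h‖ ^ 2 - ‖amp I (vacuumCoeff ι) h‖ ^ 2) := by
  have hg := (hasSum_norm_sq h).sub (norm_amp_sq (vacuumCoeff ι) h)
  simp only [vacuumCoeff_apply] at hg
  have h1 := (hasSum_tsum_swap (fun a i => sq_nonneg ‖rightAnnihilation i (h a)‖)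
    (fun a => hasSum_norm_rightAnnihilation (h a)) hg.summable).2
  rw [hg.tsum_eq] at h1
  refine h1.congr_fun fun i => ?_
  exact (norm_amp_sq (rightAnnihilation i) h).tsum_eq.symm

/-- The amplified right annihilation operators form a pure backward shift. -/
theorem isBackwardShift (I : Type*) :
    IsBackwardShift (fun i : ι => amp I (rightAnnihilation i)) (amp I (vacuumCoeff ι))
      (fun m h => ∑' a, tail m (h a)) where
  hasSum_norm := hasSum_norm_amp_rightAnnihilation I
  tail_zero h := by
    simpa only [tail_zero] using (hasSum_norm_sq h).tsum_eq
  tail_succ m h := by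
    refine (hasSum_tsum_swap (fun a i => tail_nonneg m (rightAnnihilation i (h a)))
      (fun a => hasSum_tail_succ m (h a)) ?_).2
    exact Summable.of_nonneg_of_le (fun a => tail_nonneg _ _) (fun a => tail_le _ _)
      (hasSum_norm_sq h).summable
  tail_tendsto h := by
    have h1 := tendsto_tsum_of_dominated_convergence (𝓕 := atTop)
      (f := fun (m : ℕ) a => tail m (h a)) (g := fun _ => 0)
      (hasSum_norm_sq h).summable (fun a => tendsto_tail (h a)) (Eventually.of_forall fun m a => by
        rw [Real.norm_of_nonneg (tail_nonneg _ _)]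
        exact tail_le _ _)
    simpa using h1
  surjective := by
    classical
    let β : HilbertSum I (Fock ι) →L[ℂ] HilbertSum ι (HilbertSum I (Fock ι)) :=
      column (fun i => amp I (rightAnnihilation i)) 1
        (fun h => (hasSum_norm_amp_rightAnnihilation I h).summable) fun h => by
          rw [(hasSum_norm_amp_rightAnnihilation I h).tsum_eq]
          nlinarith [sq_nonneg ‖amp I (vacuumCoeff ι) h‖]
    -- The adjoint of the column of the `B_i` is the row of right creation operators, which serves
    -- as `Θ`; the vacuum embedding serves as `δ`.
    have hβ : ∀ j v, adjoint β (lp.single 2 j v) = amp I (rightCreation j) v := fun j v => by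
      refine ext_inner_left ℂ fun x => ?_
      rw [adjoint_inner_right, lp.inner_single_right, rightCreation, ← adjoint_amp,
        adjoint_inner_right]
      rfl
    refine ⟨adjoint β, adjoint (amp I (vacuumCoeff ι)), fun g k => ⟨fun i => ?_, ?_⟩⟩
    · have h1 : amp I (rightAnnihilation i) ∘L adjoint β = lp.evalCLM ℂ _ 2 i := by
        refine clm_ext_single fun j v => ?_
        have h2 : (lp.single 2 j v : HilbertSum ι (HilbertSum I (Fock ι))) i =
            if i = j then v else 0 := by
          rw [lp.single_apply, Pi.single_apply]
        rw [comp_apply, evalCLM_apply]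
        refine Eq.trans (congrArg _ (Eq.trans (by congr!) (hβ j v)))
          (Eq.trans ?_ (h2.symm.trans (by congr!)))
        ext : 1
        funext a
        rw [amp_apply, amp_apply, rightAnnihilation_rightCreation]
        split_ifs <;> rfl
      have h3 : amp I (rightAnnihilation i) (adjoint (amp I (vacuumCoeff ι)) k) = 0 := by
        rw [adjoint_amp]
        ext : 1
        funext a
        rw [amp_apply, amp_apply, adjoint_vacuumCoeff, map_smul, rightAnnihilation_basisVec_one,
          smul_zero]
        rfl
      rw [map_add, h3, add_zero, ← comp_apply, h1, evalCLM_apply]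
    · have h1 : amp I (vacuumCoeff ι) ∘L adjoint β = 0 := by
        refine clm_ext_single fun j v => ?_
        rw [comp_apply, zero_apply]
        refine Eq.trans (congrArg _ (Eq.trans (by congr!) (hβ j v))) ?_
        ext : 1
        funext a
        rw [amp_apply, amp_apply, vacuumCoeff_apply, rightCreation_apply_one]
        rfl
      rw [map_add, ← comp_apply, h1, zero_apply, zero_add, adjoint_amp]
      ext a
      rw [amp_apply, amp_apply, adjoint_vacuumCoeff, map_smul, vacuumCoeff_apply, basisVec_self,
        smul_eq_mul, mul_one]

end FockShift

/-! ### Separation in the `w*`-topology -/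

section Separation

open Filter

variable {H : Type*} [NormedAddCommGroup H] [InnerProductSpace ℂ H]

/-- Every sum of two functionals `A ↦ ∑ ⟨y_k, A x_k⟩` is of the same form. -/
theorem exists_inner_amp_add (x y x' y' : HilbertSum ℕ H) :
    ∃ x'' y'' : HilbertSum ℕ H, ∀ A : H →L[ℂ] H,
      ⟪y'', amp ℕ A x''⟫_ℂ = ⟪y, amp ℕ A x⟫_ℂ + ⟪y', amp ℕ A x'⟫_ℂ := by
  -- Interleaving two sequences puts both series into one.
  let mix : HilbertSum ℕ H → HilbertSum ℕ H → ℕ → H := fun u v n =>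
    if Even n then u (n / 2) else v (n / 2)
  have he : ∀ u v k, mix u v (2 * k) = u k := fun u v k => by simp [mix]
  have ho : ∀ u v k, mix u v (2 * k + 1) = v k := fun u v k => by
    have h2 : (2 * k + 1) / 2 = k := by omega
    simp [mix, h2]
  have hm : ∀ u v, Memℓp (mix u v) 2 := fun u v => by
    rw [memℓp_two_iff]
    refine (HasSum.even_add_odd (f := fun n => ‖mix u v n‖ ^ 2) (m := ‖u‖ ^ 2) (m' := ‖v‖ ^ 2)
      ?_ ?_).summable
    · simpa only [he] using hasSum_norm_sq u
    · simpa only [ho] using hasSum_norm_sq v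
  refine ⟨⟨mix x x', hm _ _⟩, ⟨mix y y', hm _ _⟩, fun A => ?_⟩
  refine (lp.hasSum_inner _ _).unique (HasSum.even_add_odd ?_ ?_)
  · refine (lp.hasSum_inner y (amp ℕ A x)).congr_fun fun k => ?_
    change ⟪mix y y' (2 * k), A (mix x x' (2 * k))⟫_ℂ = _
    rw [he, he]
    rfl
  · refine (lp.hasSum_inner y' (amp ℕ A x')).congr_fun fun k => ?_
    change ⟪mix y y' (2 * k + 1), A (mix x x' (2 * k + 1))⟫_ℂ = _
    rw [ho, ho]
    rfl

theorem exists_inner_amp_sum {κ : Type*} (s : Finset κ) (x y : κ → HilbertSum ℕ H) (c : κ → ℂ) :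
    ∃ x' y' : HilbertSum ℕ H, ∀ A : H →L[ℂ] H,
      ⟪y', amp ℕ A x'⟫_ℂ = ∑ p ∈ s, c p * ⟪y p, amp ℕ A (x p)⟫_ℂ := by
  classical
  induction s using Finset.induction_on with
  | empty => exact ⟨0, 0, fun A => by simp⟩
  | insert p s hp ih =>
    obtain ⟨x₁, y₁, h₁⟩ := ih
    obtain ⟨x₂, y₂, h₂⟩ := exists_inner_amp_add (c p • x p) (y p) x₁ y₁
    refine ⟨x₂, y₂, fun A => ?_⟩
    rw [h₂, h₁, Finset.sum_insert hp, map_smul, inner_smul_right]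

/-- The defining series is an inner product after infinite amplification, so basic `w*`-functionals
become vector functionals. -/
theorem weakStarTopology_eq_induced :
    weakStarTopology H = TopologicalSpace.induced
      (fun (A : H →L[ℂ] H) (p : HilbertSum ℕ H × HilbertSum ℕ H) => ⟪p.2, amp ℕ A p.1⟫_ℂ)
      Pi.topologicalSpace := by
  rw [weakStarTopology, Pi.topologicalSpace, induced_iInf, iInf_prod]
  simp only [induced_compose]
  congr! 6

/-- A `w*`-closed subspace is separated from the operators outside it by a functional
`A ↦ ∑ ⟨y_k, A x_k⟩`. -/
theorem exists_separating (W : Submodule ℂ (H →L[ℂ] H))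
    (hW : IsClosed[weakStarTopology H] (W : Set (H →L[ℂ] H))) {T : H →L[ℂ] H} (hT : T ∉ W) :
    ∃ x y : HilbertSum ℕ H, (∀ A ∈ W, ⟪y, amp ℕ A x⟫_ℂ = 0) ∧ ⟪y, amp ℕ T x⟫_ℂ ≠ 0 := by
  classical
  rw [weakStarTopology_eq_induced, isClosed_induced_iff] at hW
  obtain ⟨C, hC, hCW⟩ := hW
  set F := fun (A : H →L[ℂ] H) (p : HilbertSum ℕ H × HilbertSum ℕ H) => ⟪p.2, amp ℕ A p.1⟫_ℂ
    with hF
  have hTC : F T ∈ Cᶜ := fun h => hT (by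
    have : T ∈ F ⁻¹' C := h
    rwa [hCW] at this)
  obtain ⟨s, u, hu, hsu⟩ := isOpen_pi_iff.1 hC.isOpen_compl (F T) hTC
  let Λ : (H →L[ℂ] H) →ₗ[ℂ] (s → ℂ) :=
    { toFun := fun A p => F A p
      map_add' := fun A B => by
        funext p
        have : amp ℕ (A + B) p.1.1 = amp ℕ A p.1.1 + amp ℕ B p.1.1 := by ext; simp
        simp only [hF, this, inner_add_right, Pi.add_apply]
      map_smul' := fun c A => by
        funext p
        have : amp ℕ (c • A) p.1.1 = c • amp ℕ A p.1.1 := by ext; simp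
        simp only [hF, this, inner_smul_right, Pi.smul_apply, smul_eq_mul, RingHom.id_apply] }
  -- An operator of `W` agreeing with `T` on the finitely many functionals in `s` would lie in the
  -- basic neighbourhood of `T` that misses `W`. So separation takes place in a finite-dimensional
  -- space.
  have hΛ : Λ T ∉ W.map Λ := by
    rintro ⟨A, hA, hAT⟩
    have h1 : F A ∈ Cᶜ := hsu fun p hp => by
      have h2 : F A p = F T p := congrFun hAT ⟨p, hp⟩
      rw [h2]
      exact (hu p hp).2
    have h3 : A ∈ F ⁻¹' C := by
      rw [hCW]
      exact hA
    exact h1 h3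
  obtain ⟨g, hg1, hg2⟩ := Submodule.exists_le_ker_of_notMem hΛ
  obtain ⟨x, y, hxy⟩ := exists_inner_amp_sum (Finset.univ : Finset s) (fun p => p.1.1)
    (fun p => p.1.2) (fun p => g (Pi.single p 1))
  have hgxy : ∀ A, ⟪y, amp ℕ A x⟫_ℂ = g (Λ A) := fun A => by
    rw [hxy, LinearMap.pi_apply_eq_sum_univ g (Λ A)]
    refine Finset.sum_congr rfl fun p _ => ?_
    rw [smul_eq_mul, mul_comm]
    congr! 2
    funext q
    simp [Pi.single_apply, eq_comm]
  refine ⟨x, y, fun A hA => ?_, ?_⟩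
  · rw [hgxy]
    exact hg2 ⟨A, hA, rfl⟩
  · rw [hgxy]
    exact hg1

/-- A weak operator functional is a defining series with a single nonzero term. -/
theorem continuous_ofCLM_weakStar [CompleteSpace H] :
    @Continuous _ _ (weakStarTopology H) _
      (ContinuousLinearMapWOT.ofCLM : (H →L[ℂ] H) → H →WOT[ℂ] H) := by
  classical
  let := weakStarTopology H
  refine ContinuousLinearMapWOT.continuous_of_dual_apply_continuous fun v f => ?_
  obtain ⟨y, rfl⟩ := (InnerProductSpace.toDual ℂ H).surjective f
  have h : Continuous[weakStarTopology H, _] fun A : H →L[ℂ] H =>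
      ∑' k, ⟪(lp.single 2 0 y : HilbertSum ℕ H) k, A ((lp.single 2 0 v : HilbertSum ℕ H) k)⟫_ℂ :=
    continuous_iInf_dom (continuous_iInf_dom continuous_induced_dom)
  convert h using 2 with A
  rw [tsum_eq_single 0]
  · simp
  · intro k hk
    simp [hk]

theorem isClosed_wotClosure [CompleteSpace H] (A : Subalgebra ℂ (H →L[ℂ] H)) :
    IsClosed[weakStarTopology H] (wotClosure A : Set (H →L[ℂ] H)) :=
  @IsClosed.preimage _ _ (weakStarTopology H) _ _ continuous_ofCLM_weakStar _ isClosed_closure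

end Separation

/-! ### Cyclic subspaces and recovery of operators from their ranges -/

section Factorization

open ContinuousLinearMap

variable {ι : Type*}

theorem map_mem_of_mem_closure_span {X Y : Type*} [NormedAddCommGroup X] [InnerProductSpace ℂ X]
    [NormedAddCommGroup Y] [InnerProductSpace ℂ Y] {S : Set X} (f : X →L[ℂ] Y)
    {K : Submodule ℂ Y} (hK : IsClosed (K : Set Y)) (h : ∀ s ∈ S, f s ∈ K) {v : X}
    (hv : v ∈ (Submodule.span ℂ S).topologicalClosure) : f v ∈ K := by
  have h1 : (Submodule.span ℂ S).topologicalClosure ≤ K.comap f.toLinearMap :=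
    Submodule.topologicalClosure_minimal _ (Submodule.span_le.2 h) (hK.preimage f.continuous)
  exact h1 hv

theorem mem_of_basisVec_mem {K : Submodule ℂ (Fock ι)} (hK : IsClosed (K : Set (Fock ι)))
    (h : ∀ w, basisVec w ∈ K) (ψ : Fock ι) : ψ ∈ K := by
  classical
  refine hK.mem_of_tendsto (lp.hasSum_single (p := 2) (by norm_num) ψ)
    (Filter.Eventually.of_forall fun s => K.sum_mem fun w _ => ?_)
  have hc : (lp.single 2 w (ψ w) : Fock ι) = ψ w • lp.single 2 w (1 : ℂ) := by
    rw [← lp.single_smul]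
    simp
  rw [hc]
  refine K.smul_mem _ ?_
  have hw := h w
  rw [basisVec] at hw
  convert hw

/-- The product of creation operators along a word. -/
def wordOp : FreeMonoid ι →* (Fock ι →L[ℂ] Fock ι) := FreeMonoid.lift creation

theorem wordOp_of_mul (i : ι) (w : FreeMonoid ι) :
    wordOp (FreeMonoid.of i * w) = creation i * wordOp w := by
  rw [map_mul, wordOp, FreeMonoid.lift_eval_of]

variable {κ : Type*}

theorem amp_wordOp_one (x : HilbertSum κ (Fock ι)) : amp κ (wordOp 1) x = x := by
  rw [map_one]
  rfl

theorem amp_wordOp_of_mul (i : ι) (w : FreeMonoid ι) (x : HilbertSum κ (Fock ι)) :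
    amp κ (wordOp (FreeMonoid.of i * w)) x = amp κ (creation i) (amp κ (wordOp w) x) := by
  rw [wordOp_of_mul]
  rfl

open Classical in
theorem amp_annihilation_creation (i j : ι) (x : HilbertSum κ (Fock ι)) :
    amp κ (annihilation i) (amp κ (creation j) x) = if i = j then x else 0 := by
  ext : 1
  funext a
  rw [amp_apply, amp_apply, annihilation_creation]
  split_ifs <;> rfl

open Classical in
theorem inner_amp_creation (i j : ι) (x y : HilbertSum κ (Fock ι)) :
    ⟪amp κ (creation i) x, amp κ (creation j) y⟫_ℂ = if i = j then ⟪x, y⟫_ℂ else 0 := by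
  rw [← adjoint_inner_right, adjoint_amp, amp_annihilation_creation]
  split_ifs
  · rfl
  · rw [inner_zero_right]

/-- The closed cyclic subspace generated by `x` under the amplified creation operators. -/
def cyclicSpan (x : HilbertSum κ (Fock ι)) : Submodule ℂ (HilbertSum κ (Fock ι)) :=
  (Submodule.span ℂ (Set.range fun w => amp κ (wordOp w) x)).topologicalClosure

/-- A vector of an amplified Fock space lies in the range of an isometry from the Fock space onto
its cyclic subspace, intertwining the creation operators. -/
theorem exists_intertwiner (x : HilbertSum κ (Fock ι)) (hx : x ≠ 0) :
    ∃ V : Fock ι →L[ℂ] HilbertSum κ (Fock ι),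
      (∀ i ψ, V (creation i ψ) = amp κ (creation i) (V ψ)) ∧ (∃ ξ, V ξ = x) ∧
      ∀ ψ, V ψ ∈ cyclicSpan x := by
  classical
  set E := cyclicSpan x with hE
  have hEc : IsClosed (E : Set (HilbertSum κ (Fock ι))) := Submodule.isClosed_topologicalClosure _
  have hwE : ∀ w, amp κ (wordOp w) x ∈ E := fun w =>
    Submodule.le_topologicalClosure _ (Submodule.subset_span ⟨w, rfl⟩)
  have hxE : x ∈ E := by simpa only [amp_wordOp_one] using hwE 1
  -- The part of the cyclic subspace generated by nonempty words; the component `z` of `x`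
  -- orthogonal to it is the wandering vector.
  set L : Submodule ℂ (HilbertSum κ (Fock ι)) := (Submodule.span ℂ (Set.range fun p : ι × _ =>
    amp κ (wordOp (FreeMonoid.of p.1 * p.2)) x)).topologicalClosure with hL
  have hLc : IsClosed (L : Set (HilbertSum κ (Fock ι))) := Submodule.isClosed_topologicalClosure _
  have : CompleteSpace L := hLc.completeSpace_coe
  have hwL : ∀ i w, amp κ (wordOp (FreeMonoid.of i * w)) x ∈ L := fun i w =>
    Submodule.le_topologicalClosure _ (Submodule.subset_span ⟨(i, w), rfl⟩)
  have hLE : L ≤ E := fun v hv =>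
    map_mem_of_mem_closure_span (ContinuousLinearMap.id ℂ _) hEc
      (by rintro _ ⟨p, rfl⟩; exact hwE _) hv
  have hEL : ∀ i, ∀ v ∈ E, amp κ (creation i) v ∈ L := fun i v hv =>
    map_mem_of_mem_closure_span _ hLc
      (by rintro _ ⟨w, rfl⟩; rw [← amp_wordOp_of_mul]; exact hwL i w) hv
  have hLE' : ∀ i, ∀ v ∈ L, amp κ (annihilation i) v ∈ E := fun i v hv => by
    refine map_mem_of_mem_closure_span _ hEc ?_ hv
    rintro _ ⟨⟨j, w⟩, rfl⟩
    simp only [amp_wordOp_of_mul, amp_annihilation_creation]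
    split_ifs
    · exact hwE w
    · exact E.zero_mem
  have hL1 : ∀ v ∈ L, ∀ a, v a 1 = 0 := fun v hv a => by
    have h1 := map_mem_of_mem_closure_span (K := ⊥) (vacuumCoeff ι ∘L lp.evalCLM ℂ _ 2 a)
      (by simp) ?_ hv
    · exact (Submodule.mem_bot ℂ).1 h1
    · rintro _ ⟨⟨j, w⟩, rfl⟩
      rw [Submodule.mem_bot]
      simp only [amp_wordOp_of_mul]
      exact creation_apply_one j _
  set z := x - L.starProjection x with hz
  have hzL : ∀ v ∈ L, ⟪v, z⟫_ℂ = 0 := fun v hv =>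
    (Submodule.sub_starProjection_mem_orthogonal x) v hv
  have hzE : z ∈ E := E.sub_mem hxE (hLE (L.starProjection_apply_mem x))
  have hwzE : ∀ w, amp κ (wordOp w) z ∈ E := fun w => by
    induction w using FreeMonoid.inductionOn' with
    | one => rwa [amp_wordOp_one]
    | of_mul i w ih =>
      rw [amp_wordOp_of_mul]
      exact hLE (hEL i _ ih)
  have horth : ∀ v w, v ≠ w → ⟪amp κ (wordOp v) z, amp κ (wordOp w) z⟫_ℂ = 0 := fun v => by
    induction v using FreeMonoid.inductionOn' with
    | one =>
      intro w hw
      rcases word_cases_left w with rfl | ⟨i, w, rfl⟩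
      · exact absurd rfl hw
      · rw [amp_wordOp_one, amp_wordOp_of_mul, ← inner_conj_symm, hzL _ (hEL i _ (hwzE w)),
          map_zero]
    | of_mul i v ih =>
      intro w hw
      rcases word_cases_left w with rfl | ⟨j, w, rfl⟩
      · rw [amp_wordOp_one, amp_wordOp_of_mul, hzL _ (hEL i _ (hwzE v))]
      · rw [amp_wordOp_of_mul, amp_wordOp_of_mul, inner_amp_creation]
        split_ifs with hij
        · subst hij
          exact ih w fun h => hw (by rw [h])
        · rfl
  have hnorm : ∀ v, ⟪amp κ (wordOp v) z, amp κ (wordOp v) z⟫_ℂ = ⟪z, z⟫_ℂ := fun v => by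
    induction v using FreeMonoid.inductionOn' with
    | one => rw [amp_wordOp_one]
    | of_mul i v ih => rw [amp_wordOp_of_mul, inner_amp_creation, if_pos rfl, ih]
  -- Modulo `L` only the empty word survives, so the wandering subspace is the line through `z`.
  have hEz : ∀ v ∈ E, v - L.starProjection v ∈ Submodule.span ℂ {z} := fun v hv => by
    have h1 := map_mem_of_mem_closure_span (K := Submodule.span ℂ {z})
      (ContinuousLinearMap.id ℂ _ - L.starProjection) (Submodule.closed_of_finiteDimensional _)
      ?_ hv
    · simpa using h1
    · rintro _ ⟨w, rfl⟩
      rcases word_cases_left w with rfl | ⟨i, w, rfl⟩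
      · simp only [amp_wordOp_one]
        exact Submodule.mem_span_singleton_self z
      · have h2 := Submodule.starProjection_eq_self_iff.2 (hwL i w)
        simp only [sub_apply, coe_id', id_eq, h2, sub_self]
        exact Submodule.zero_mem _
  -- Such a `v` lies in `L`, hence has no vacuum coefficient, and each `S_i* v` satisfies the same
  -- hypotheses. Induction on the word then kills every coefficient: the translates of `z` are total
  -- in `E`.
  have hzero : ∀ w, ∀ v ∈ E, (∀ α, ⟪amp κ (wordOp α) z, v⟫_ℂ = 0) → ∀ a, v a w = 0 := fun w => by
    have hvL : ∀ v ∈ E, (∀ α, ⟪amp κ (wordOp α) z, v⟫_ℂ = 0) → v ∈ L := fun v hv hα => by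
      obtain ⟨c, hc⟩ := Submodule.mem_span_singleton.1 (hEz v hv)
      have h1 : ⟪z, v⟫_ℂ = 0 := by simpa only [amp_wordOp_one] using hα 1
      have h2 : ⟪z, L.starProjection v⟫_ℂ = 0 := by
        rw [← inner_conj_symm, hzL _ (L.starProjection_apply_mem v), map_zero]
      have h3 : ⟪c • z, c • z⟫_ℂ = 0 := by
        rw [inner_smul_left, hc, inner_sub_right, h1, h2, sub_zero, mul_zero]
      rw [inner_self_eq_zero] at h3
      rw [h3] at hc
      rw [sub_eq_zero.1 hc.symm]
      exact L.starProjection_apply_mem v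
    induction w using FreeMonoid.inductionOn' with
    | one => exact fun v hv hα => hL1 v (hvL v hv hα)
    | of_mul i w ih =>
      intro v hv hα a
      have h1 := ih (amp κ (annihilation i) v) (hLE' i v (hvL v hv hα)) (fun α => by
        rw [← adjoint_amp, adjoint_inner_right, ← amp_wordOp_of_mul]
        exact hα _) a
      rwa [amp_apply, annihilation_apply] at h1
  have hzero' : ∀ v ∈ E, (∀ α, ⟪amp κ (wordOp α) z, v⟫_ℂ = 0) → v = 0 := fun v hv hα => by
    ext : 1
    funext a
    ext w
    exact hzero w v hv hα a
  have hz0 : z ≠ 0 := fun h => hx (hzero' x hxE fun α => by rw [h, map_zero, inner_zero_left])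
  have hzn : (‖z‖ : ℂ) ≠ 0 := by simpa using hz0
  have hon : Orthonormal ℂ fun α => amp κ (wordOp α) ((‖z‖ : ℂ)⁻¹ • z) := by
    rw [orthonormal_iff_ite]
    intro v w
    rw [map_smul, map_smul, inner_smul_left, inner_smul_right]
    split_ifs with h
    · subst h
      rw [hnorm, inner_self_eq_norm_sq_to_K, map_inv₀, Complex.conj_ofReal]
      change (‖z‖ : ℂ)⁻¹ * ((‖z‖ : ℂ)⁻¹ * (‖z‖ : ℂ) ^ 2) = 1
      field_simp
    · rw [horth v w h, mul_zero, mul_zero]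
  let V := hon.orthogonalFamily.linearIsometry
  have hVe : ∀ α, V (basisVec α) = amp κ (wordOp α) ((‖z‖ : ℂ)⁻¹ • z) := fun α => by
    have h1 := hon.orthogonalFamily.linearIsometry_apply_single (i := α) (1 : ℂ)
    rw [LinearIsometry.toSpanSingleton_apply, one_smul] at h1
    rw [← h1]
    change hon.orthogonalFamily.linearIsometry _ = _
    rw [basisVec]
  have hVE : ∀ ψ, V ψ ∈ E := fun ψ => by
    refine mem_of_basisVec_mem (K := E.comap V.toContinuousLinearMap.toLinearMap)
      (hEc.preimage V.continuous) (fun w => ?_) ψ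
    change V (basisVec w) ∈ E
    rw [hVe, map_smul]
    exact E.smul_mem _ (hwzE w)
  refine ⟨V.toContinuousLinearMap, fun i ψ => ?_, ?_, hVE⟩
  · have h1 : V.toContinuousLinearMap ∘L creation i =
        amp κ (creation i) ∘L V.toContinuousLinearMap := by
      refine fock_clm_ext fun w => ?_
      change V (creation i (basisVec w)) = amp κ (creation i) (V (basisVec w))
      rw [creation_basisVec, hVe, hVe, amp_wordOp_of_mul]
    exact congrArg (fun f => f ψ) h1
  · let K := LinearMap.range V.toLinearMap
    have : CompleteSpace K := by
      have := V.isometry.isUniformInducing.isComplete_range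
      exact IsComplete.completeSpace_coe (s := (K : Set _)) (by convert this)
    obtain ⟨ξ, hξ⟩ := K.starProjection_apply_mem x
    refine ⟨ξ, ?_⟩
    -- The remainder lies in `E` and is orthogonal to all translates of `z`, so it vanishes and `x`
    -- is in the range of `V`.
    have h1 : x - K.starProjection x = 0 := by
      refine hzero' _ (E.sub_mem hxE ?_) fun α => ?_
      · rw [← hξ]
        exact hVE ξ
      · have h2 := (Submodule.sub_starProjection_mem_orthogonal (K := K) x) (V (basisVec α))
          ⟨_, rfl⟩
        rw [hVe, map_smul, inner_smul_left, mul_eq_zero] at h2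
        refine h2.resolve_left ?_
        rw [map_inv₀, Complex.conj_ofReal]
        exact inv_ne_zero hzn
    rw [sub_eq_zero] at h1
    rw [h1]
    exact hξ

/-- A `w*`-closed space of operators commuting with the right creation operators and stable under
right multiplication by the left creation operators is determined by its range. -/
theorem mem_of_range_le (W : Submodule ℂ (Fock ι →L[ℂ] Fock ι))
    (hW : IsClosed[weakStarTopology (Fock ι)] (W : Set (Fock ι →L[ℂ] Fock ι)))
    (hWR : ∀ f ∈ W, ∀ i, f ∘L rightCreation i = rightCreation i ∘L f)
    (hWS : ∀ f ∈ W, ∀ i, f ∘L creation i ∈ W)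
    {h : Fock ι →L[ℂ] Fock ι} (hR : ∀ i, h ∘L rightCreation i = rightCreation i ∘L h)
    (hh : ∀ ψ, h ψ ∈ (Submodule.span ℂ {v | ∃ f ∈ W, ∃ ψ : Fock ι, v = f ψ}).topologicalClosure) :
    h ∈ W := by
  by_contra hn
  obtain ⟨x, y, hxy, hne⟩ := exists_separating W hW hn
  refine hne ?_
  have hx : x ≠ 0 := by
    rintro rfl
    simp at hne
  obtain ⟨V, hV, ⟨ξ, hξ⟩, hVx⟩ := exists_intertwiner x hx
  -- Each coordinate of `V` commutes with the left creation operators, hence with everything in the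
  -- commutant of the right ones.
  have hcomm : ∀ T : Fock ι →L[ℂ] Fock ι, (∀ i, T ∘L rightCreation i = rightCreation i ∘L T) →
      ∀ ψ, amp ℕ T (V ψ) = V (T ψ) := fun T hT ψ => by
    ext : 1
    funext a
    refine commute_of_commute_left_right (G := lp.evalCLM ℂ _ 2 a ∘L V) (fun i => ?_) hT ψ
    ext1 φ
    change V (creation i φ) a = creation i (V φ a)
    rw [hV]
    rfl
  have hWw : ∀ f ∈ W, ∀ w, f * wordOp w ∈ W := fun f hf w => by
    induction w using FreeMonoid.inductionOn' generalizing f with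
    | one => simpa using hf
    | of_mul i w ih =>
      rw [wordOp_of_mul, ← mul_assoc]
      exact ih _ (hWS f hf i)
  -- The functional vanishes on `f` times any word, so `y` is orthogonal to `f^(∞)` of the cyclic
  -- subspace of `x`, which contains the range of `V`.
  have hyV : ∀ f ∈ W, ∀ ψ, ⟪y, V (f ψ)⟫_ℂ = 0 := fun f hf ψ => by
    rw [← hcomm f (hWR f hf)]
    have h1 := map_mem_of_mem_closure_span (K := ⊥) (innerSL ℂ y ∘L amp ℕ f) (by simp) ?_ (hVx ψ)
    · simpa using h1
    · rintro _ ⟨w, rfl⟩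
      have h2 := hxy _ (hWw f hf w)
      simpa using! h2
  rw [← hξ, hcomm h hR]
  have h1 := map_mem_of_mem_closure_span (K := ⊥) (innerSL ℂ y ∘L V) (by simp) ?_ (hh ξ)
  · simpa using h1
  · rintro _ ⟨f, hf, ψ, rfl⟩
    simpa using hyV f hf ψ

end Factorization

/-! ### The algebra `F^∞`, its ideals and their compressions -/

section Toeplitz

open ContinuousLinearMap

variable {ι : Type*}

/-- Left and right creation operators commute, and commuting with a fixed operator is a closed
condition in both the norm and the weak operator topology. -/
theorem toeplitzAlgebra_commute {f : Fock ι →L[ℂ] Fock ι} (hf : f ∈ toeplitzAlgebra ι) (i : ι) :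
    f ∘L rightCreation i = rightCreation i ∘L f := by
  have h1 : discAlgebra ι ≤ Subalgebra.centralizer ℂ {rightCreation i} := by
    refine Subalgebra.topologicalClosure_minimal (Algebra.adjoin_le ?_)
      (Set.isClosed_centralizer _)
    rintro _ ⟨j, rfl⟩
    refine (Subalgebra.mem_centralizer_iff ℂ).2 ?_
    rintro _ rfl
    exact (creation_comp_rightCreation j i).symm
  let R := ContinuousLinearMapWOT.ofCLM (rightCreation i)
  have h2 : IsClosed {B : Fock ι →WOT[ℂ] Fock ι | B.comp R = R.comp B} :=
    isClosed_eq (ContinuousLinearMapWOT.continuous_precomp R)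
      (ContinuousLinearMapWOT.continuous_postcomp R)
  have h3 : ContinuousLinearMapWOT.ofCLM f ∈ {B : Fock ι →WOT[ℂ] Fock ι | B.comp R = R.comp B} := by
    refine closure_minimal ?_ h2 hf
    rintro _ ⟨g, hg, rfl⟩
    have h4 := (Subalgebra.mem_centralizer_iff ℂ).1 (h1 hg) _ rfl
    exact congrArg ContinuousLinearMapWOT.ofCLM h4.symm
  exact congrArg ContinuousLinearMapWOT.toCLM h3

theorem creation_mem_toeplitzAlgebra (i : ι) : creation i ∈ toeplitzAlgebra ι :=
  subset_closure ⟨_, Subalgebra.le_topologicalClosure _ (Algebra.subset_adjoin ⟨i, rfl⟩), rfl⟩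

/-- The noncommutative analytic Toeplitz algebra is the commutant of the right creation
operators. -/
theorem mem_toeplitzAlgebra_iff {f : Fock ι →L[ℂ] Fock ι} :
    f ∈ toeplitzAlgebra ι ↔ ∀ i, f ∘L rightCreation i = rightCreation i ∘L f := by
  refine ⟨toeplitzAlgebra_commute, fun h => ?_⟩
  refine mem_of_range_le (Subalgebra.toSubmodule (toeplitzAlgebra ι)) (isClosed_wotClosure _)
    (fun f hf => toeplitzAlgebra_commute hf)
    (fun f hf i => (toeplitzAlgebra ι).mul_mem hf (creation_mem_toeplitzAlgebra i)) h fun ψ => ?_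
  -- The range condition is vacuous since `F^∞` contains the identity.
  exact Submodule.le_topologicalClosure _
    (Submodule.subset_span ⟨1, (toeplitzAlgebra ι).one_mem, f ψ, rfl⟩)

variable (J : Ideal (toeplitzAlgebra ι))

theorem mem_idealSpace {f : Fock ι →L[ℂ] Fock ι} :
    f ∈ idealSpace J ↔ ∃ hf : f ∈ toeplitzAlgebra ι, (⟨f, hf⟩ : toeplitzAlgebra ι) ∈ J := by
  constructor
  · rintro ⟨g, hg, rfl⟩
    exact ⟨g.2, hg⟩
  · rintro ⟨hf, hg⟩
    exact ⟨⟨f, hf⟩, hg, rfl⟩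

theorem isClosed_idealRange : IsClosed (idealRange J : Set (Fock ι)) :=
  Submodule.isClosed_topologicalClosure _

theorem orthogonal_coRange : (coRange J)ᗮ = idealRange J := by
  have : CompleteSpace (idealRange J) := (isClosed_idealRange J).completeSpace_coe
  exact Submodule.orthogonal_orthogonal _

variable {J}

theorem apply_mem_idealRange {f : Fock ι →L[ℂ] Fock ι} (hf : f ∈ idealSpace J) (ψ : Fock ι) :
    f ψ ∈ idealRange J :=
  Submodule.le_topologicalClosure _ (Submodule.subset_span ⟨f, hf, ψ, rfl⟩)

theorem toeplitz_apply_mem_idealRange {g : Fock ι →L[ℂ] Fock ι} (hg : g ∈ toeplitzAlgebra ι)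
    {v : Fock ι} (hv : v ∈ idealRange J) : g v ∈ idealRange J := by
  refine map_mem_of_mem_closure_span g (isClosed_idealRange J) ?_ hv
  rintro _ ⟨f, hf, ψ, rfl⟩
  obtain ⟨hf', hfJ⟩ := (mem_idealSpace J).1 hf
  exact apply_mem_idealRange (f := g * f)
    ((mem_idealSpace J).2 ⟨(toeplitzAlgebra ι).mul_mem hg hf', J.mul_mem_left ⟨g, hg⟩ hfJ⟩) ψ

theorem rightCreation_mem_idealRange (i : ι) {v : Fock ι} (hv : v ∈ idealRange J) :
    rightCreation i v ∈ idealRange J := by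
  refine map_mem_of_mem_closure_span _ (isClosed_idealRange J) ?_ hv
  rintro _ ⟨f, hf, ψ, rfl⟩
  have h1 := toeplitzAlgebra_commute ((mem_idealSpace J).1 hf).1 i
  rw [← comp_apply, ← h1]
  exact apply_mem_idealRange hf _

theorem rightAnnihilation_mem_coRange (i : ι) {v : Fock ι} (hv : v ∈ coRange J) :
    rightAnnihilation i v ∈ coRange J := fun u hu => by
  rw [← adjoint_rightCreation, adjoint_inner_right]
  exact hv _ (rightCreation_mem_idealRange i hu)

theorem projection_eq_zero_iff {v : Fock ι} :
    (coRange J).orthogonalProjectionOnto v = 0 ↔ v ∈ idealRange J := by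
  rw [Submodule.orthogonalProjectionOnto_eq_zero_iff, orthogonal_coRange]

/-- Two-sidedness enters here: `J` must absorb the left creation operators from the right for
`mem_of_range_le` to apply. -/
theorem mem_idealSpace_of_range [J.IsTwoSided]
    (hJ : IsClosed[weakStarTopology (Fock ι)] (idealSpace J : Set (Fock ι →L[ℂ] Fock ι)))
    {h : Fock ι →L[ℂ] Fock ι} (hh : h ∈ toeplitzAlgebra ι) (hr : ∀ ψ, h ψ ∈ idealRange J) :
    h ∈ idealSpace J := by
  refine mem_of_range_le (idealSpace J) hJ
    (fun f hf => toeplitzAlgebra_commute ((mem_idealSpace J).1 hf).1) (fun f hf i => ?_)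
    (toeplitzAlgebra_commute hh) hr
  obtain ⟨hf', hfJ⟩ := (mem_idealSpace J).1 hf
  exact (mem_idealSpace J).2 ⟨(toeplitzAlgebra ι).mul_mem hf' (creation_mem_toeplitzAlgebra i),
    J.mul_mem_right ⟨_, creation_mem_toeplitzAlgebra i⟩ hfJ⟩

theorem compression_ideal {f : Fock ι →L[ℂ] Fock ι} (hf : f ∈ idealSpace J) :
    compression (coRange J) f = 0 := by
  ext1 v
  exact projection_eq_zero_iff.2 (apply_mem_idealRange hf _)

/-- The part of `g v` lost under projection lies in `ℳ_J`, which `f` leaves invariant. -/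
theorem compression_mul {f g : Fock ι →L[ℂ] Fock ι} (hf : f ∈ toeplitzAlgebra ι) :
    compression (coRange J) (f * g) = compression (coRange J) f * compression (coRange J) g := by
  ext1 v
  change (coRange J).orthogonalProjectionOnto (f (g v)) = (coRange J).orthogonalProjectionOnto
    (f ((coRange J).orthogonalProjectionOnto (g v)))
  rw [← sub_eq_zero, ← map_sub, ← map_sub, projection_eq_zero_iff]
  refine toeplitz_apply_mem_idealRange hf ?_
  have h1 := (coRange J).sub_starProjection_mem_orthogonal (g v)
  rwa [orthogonal_coRange] at h1

variable {I : Type*}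

/-- The entrywise compression of an operator matrix to a subspace. -/
def matrixCompression {H : Type*} [NormedAddCommGroup H] [InnerProductSpace ℂ H]
    (N : Submodule ℂ H) [N.HasOrthogonalProjection] (I : Type*) :
    (HilbertSum I H →L[ℂ] HilbertSum I H) →ₗ[ℂ] (HilbertSum I N →L[ℂ] HilbertSum I N) where
  toFun F := amp I N.orthogonalProjectionOnto ∘L F ∘L amp I N.subtypeL
  map_add' F G := by ext; simp
  map_smul' c F := by ext; simp

theorem entry_matrixCompression {H : Type*} [NormedAddCommGroup H] [InnerProductSpace ℂ H]
    (N : Submodule ℂ H) [N.HasOrthogonalProjection]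
    (F : HilbertSum I H →L[ℂ] HilbertSum I H) (α β : I) :
    entry (matrixCompression N I F) α β = compression N (entry F α β) :=
  entry_amp_comp _ _ F α β

theorem norm_matrixCompression_le {H : Type*} [NormedAddCommGroup H] [InnerProductSpace ℂ H]
    (N : Submodule ℂ H) [N.HasOrthogonalProjection]
    (F : HilbertSum I H →L[ℂ] HilbertSum I H) : ‖matrixCompression N I F‖ ≤ ‖F‖ := by
  have h1 : ‖amp I N.orthogonalProjectionOnto‖ ≤ 1 :=
    (norm_amp_le _).trans N.orthogonalProjectionOnto_norm_le
  have h2 : ‖amp I N.subtypeL‖ ≤ 1 := (norm_amp_le _).trans N.norm_subtypeL_le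
  calc ‖amp I N.orthogonalProjectionOnto ∘L F ∘L amp I N.subtypeL‖
      ≤ ‖amp I N.orthogonalProjectionOnto‖ * (‖F‖ * ‖amp I N.subtypeL‖) :=
        (opNorm_comp_le _ _).trans (mul_le_mul_of_nonneg_left (opNorm_comp_le _ _) (norm_nonneg _))
    _ ≤ 1 * (‖F‖ * 1) := by gcongr
    _ = ‖F‖ := by ring

theorem matrixCompression_eq_zero {F : HilbertSum I (Fock ι) →L[ℂ] HilbertSum I (Fock ι)}
    (hF : F ∈ matrixSpace I (idealSpace J)) : matrixCompression (coRange J) I F = 0 := by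
  apply entry_injective
  funext α β
  rw [entry_matrixCompression, compression_ideal (hF α β)]
  ext
  simp [entry]

theorem norm_adjoint {H : Type*} [NormedAddCommGroup H] [InnerProductSpace ℂ H] [CompleteSpace H]
    (T : H →L[ℂ] H) : ‖adjoint T‖ = ‖T‖ :=
  LinearIsometryEquiv.norm_map adjoint T

/-- Commutant lifting for operator matrices on the Fock space: an operator that commutes with the
right creation operators, and whose adjoint leaves `⊕_I N` invariant, has the same compression
to `N` as an operator of minimal norm. -/
theorem exists_lift {N : Submodule ℂ (Fock ι)} [CompleteSpace N]
    (hN : ∀ i, ∀ v ∈ N, rightAnnihilation i v ∈ N)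
    {F : HilbertSum I (Fock ι) →L[ℂ] HilbertSum I (Fock ι)}
    (hFR : ∀ i, F ∘L amp I (rightCreation i) = amp I (rightCreation i) ∘L F)
    (hFN : ∀ v a, adjoint F (amp I N.subtypeL v) a ∈ N) :
    ∃ G : HilbertSum I (Fock ι) →L[ℂ] HilbertSum I (Fock ι),
      (∀ i, G ∘L amp I (rightCreation i) = amp I (rightCreation i) ∘L G) ∧
      amp I N.orthogonalProjectionOnto ∘L F = amp I N.orthogonalProjectionOnto ∘L G ∧
      ‖G‖ ≤ ‖matrixCompression N I F‖ := by
  let j : HilbertSum I N →L[ℂ] HilbertSum I (Fock ι) := amp I N.subtypeL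
  have hj : ∀ v, ‖j v‖ = ‖v‖ := fun v => by
    rw [← sq_eq_sq₀ (norm_nonneg _) (norm_nonneg _)]
    exact (hasSum_norm_sq (j v)).unique (hasSum_norm_sq v)
  have hjinj : Function.Injective j := (AddMonoidHomClass.isometry_of_norm j hj).injective
  have hjadj : adjoint j = amp I N.orthogonalProjectionOnto := by
    rw [adjoint_amp, Submodule.adjoint_subtypeL]
  let b : ι → HilbertSum I N →L[ℂ] HilbertSum I N := fun i =>
    amp I ((rightAnnihilation i ∘L N.subtypeL).codRestrict N fun v => hN i v v.2)
  have hb : ∀ i v, j (b i v) = amp I (rightAnnihilation i) (j v) := fun i v => rfl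
  have hXadj : adjoint (matrixCompression N I F) = adjoint j ∘L adjoint F ∘L j := by
    change adjoint (amp I N.orthogonalProjectionOnto ∘L F ∘L j) = _
    rw [adjoint_comp, adjoint_comp, ← hjadj, adjoint_adjoint]
    rfl
  generalize matrixCompression N I F = X at hXadj ⊢
  -- Invariance under the adjoint of `F` makes the adjoint of the compression a mere restriction,
  -- which is what makes it commute with the `b i`.
  have hjX : ∀ v, j (adjoint X v) = adjoint F (j v) := fun v => by
    rw [hXadj, hjadj]
    ext : 1
    funext a
    exact N.starProjection_eq_self_iff.2 (hFN v a)
  have hFB : ∀ i v, adjoint F (amp I (rightAnnihilation i) v) =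
      amp I (rightAnnihilation i) (adjoint F v) := fun i v => by
    have h1 := congrArg adjoint (hFR i)
    rw [adjoint_comp, adjoint_comp, adjoint_amp, adjoint_rightCreation] at h1
    exact (congrArg (fun T => T v) h1).symm
  have hcomm : ∀ i v, adjoint X (b i v) = b i (adjoint X v) := fun i v => by
    apply hjinj
    rw [hjX, hb, hFB, hb, hjX]
  obtain ⟨Z, hZn, hZB, hZj⟩ :=
    (isBackwardShift I).exists_extension j hj b hb (adjoint X) hcomm
  refine ⟨adjoint Z, fun i => ?_, ?_, ?_⟩
  · have h1 : Z ∘L amp I (rightAnnihilation i) = amp I (rightAnnihilation i) ∘L Z :=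
      ContinuousLinearMap.ext (hZB i)
    have h2 := congrArg adjoint h1
    rw [adjoint_comp, adjoint_comp, adjoint_amp] at h2
    exact h2.symm
  · have h1 : adjoint F ∘L j = Z ∘L j :=
      ContinuousLinearMap.ext fun v => ((hZj v).trans (hjX v)).symm
    have h2 := congrArg adjoint h1
    rwa [adjoint_comp, adjoint_comp, adjoint_adjoint, hjadj] at h2
  · exact (norm_adjoint Z).trans_le (hZn.trans (norm_adjoint X).le)

/-- Every coset of `M_γ(J)` in `M_γ(F^∞)` contains an element whose norm is that of the
compression to `𝒩_J`. -/
theorem exists_representative [J.IsTwoSided]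
    (hJ : IsClosed[weakStarTopology (Fock ι)] (idealSpace J : Set (Fock ι →L[ℂ] Fock ι)))
    {F : HilbertSum I (Fock ι) →L[ℂ] HilbertSum I (Fock ι)}
    (hF : F ∈ matrixSpace I (Subalgebra.toSubmodule (toeplitzAlgebra ι))) :
    ∃ G ∈ matrixSpace I (Subalgebra.toSubmodule (toeplitzAlgebra ι)),
      F - G ∈ matrixSpace I (idealSpace J) ∧ ‖G‖ ≤ ‖matrixCompression (coRange J) I F‖ := by
  classical
  -- Dual to the invariance of `ℳ_J` under the entries of `F`.
  have hFN : ∀ v a, adjoint F (amp I (coRange J).subtypeL v) a ∈ coRange J := fun v a m hm => by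
    have h1 := lp.inner_single_left (𝕜 := ℂ) (G := fun _ : I => Fock ι) a m
      (adjoint F (amp I (coRange J).subtypeL v))
    rw [← h1, adjoint_inner_right, lp.inner_eq_tsum]
    refine (tsum_congr fun c => ?_).trans tsum_zero
    rw [← entry_apply]
    exact (v c).2 _ (toeplitz_apply_mem_idealRange (hF c a) hm)
  obtain ⟨G, hGR, hFG, hn⟩ := exists_lift (fun i v hv => rightAnnihilation_mem_coRange i hv)
    (fun i => (commute_amp_iff _ _).2 fun α β => toeplitzAlgebra_commute (hF α β) i) hFN
  have hG : G ∈ matrixSpace I (Subalgebra.toSubmodule (toeplitzAlgebra ι)) := fun α β =>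
    mem_toeplitzAlgebra_iff.2 fun i => (commute_amp_iff G (rightCreation i)).1 (hGR i) α β
  refine ⟨G, hG, fun α β => ?_, hn⟩
  rw [entry_sub]
  refine mem_idealSpace_of_range hJ ((toeplitzAlgebra ι).sub_mem (hF α β) (hG α β)) fun ψ => ?_
  rw [← projection_eq_zero_iff, sub_apply, map_sub, sub_eq_zero, entry_apply, entry_apply]
  exact congrArg (fun T => T (lp.single 2 β ψ) α) hFG

/-- One inequality is the norm of the lifted representative; the other holds because compression is
contractive and constant on cosets. -/
theorem norm_mk_matrixIdeal [J.IsTwoSided]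
    (hJ : IsClosed[weakStarTopology (Fock ι)] (idealSpace J : Set (Fock ι →L[ℂ] Fock ι)))
    (f : matrixSpace I (Subalgebra.toSubmodule (toeplitzAlgebra ι))) :
    ‖(Submodule.Quotient.mk f : _ ⧸ matrixIdeal I J)‖ =
      ‖matrixCompression (coRange J) I f.1‖ := by
  refine le_antisymm ?_ (le_of_forall_pos_le_add fun ε hε => ?_)
  · obtain ⟨G, hG, hFG, hn⟩ := exists_representative hJ f.2
    have h1 : (Submodule.Quotient.mk f : _ ⧸ matrixIdeal I J) =
        Submodule.Quotient.mk ⟨G, hG⟩ := (Submodule.Quotient.eq _).2 hFG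
    rw [h1]
    exact (Submodule.Quotient.norm_mk_le _ _).trans hn
  · obtain ⟨g, hgf, hg⟩ :=
      Submodule.Quotient.norm_mk_lt (Submodule.Quotient.mk f : _ ⧸ matrixIdeal I J) hε
    have h1 : g - f ∈ matrixIdeal I J := (Submodule.Quotient.eq _).1 hgf
    have h2 : matrixCompression (coRange J) I (g.1 - f.1) = 0 := matrixCompression_eq_zero h1
    rw [map_sub, sub_eq_zero] at h2
    rw [← h2]
    exact (norm_matrixCompression_le (coRange J) g.1).trans hg.le

theorem entry_ofMatrix {H : Type*} [NormedAddCommGroup H] [InnerProductSpace ℂ H]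
    [Fintype I] [DecidableEq I] (a : I → I → H →L[ℂ] H) (α β : I) :
    entry (ofMatrix a) α β = a α β := by
  ext v
  have h1 : ∀ i : I, (lp.single 2 β v : HilbertSum I H) i = if i = β then v else 0 := fun i => by
    rw [lp.single_apply, Pi.single_apply]
  rw [entry_apply]
  change lp.evalCLM ℂ (fun _ : I => H) 2 α (ofMatrix a (lp.single 2 β v)) = _
  simp only [ofMatrix, sum_apply, map_sum, comp_apply, evalCLM_apply,
    lp.singleContinuousLinearMap_apply, h1]
  rw [Finset.sum_eq_single α, Finset.sum_eq_single β]
  · simp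
  · intro i _ hi
    simp [hi]
  · simp
  · intro i _ hi
    refine Finset.sum_eq_zero fun c _ => ?_
    exact lp.single_apply_ne 2 i _ hi.symm
  · simp

variable (J) in
/-- The compression homomorphism `F^∞ → B(𝒩_J)`. -/
def compressionHom : toeplitzAlgebra ι →ₐ[ℂ] (coRange J →L[ℂ] coRange J) :=
  AlgHom.ofLinearMap
    { toFun := fun f => compression (coRange J) (f : Fock ι →L[ℂ] Fock ι)
      map_add' := fun f g => by ext; simp [compression]
      map_smul' := fun c f => by ext; simp [compression] }
    (by
      ext1 v
      exact Submodule.orthogonalProjectionOnto_mem_subspace_eq_self v)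
    fun f g => compression_mul f.2

end Toeplitz

end NCToeplitz

end

theorem theorem2p9 {ι : Type*} [Nonempty ι] [Countable ι]
    (J : Ideal (toeplitzAlgebra ι)) [J.IsTwoSided]
    (hJ : IsClosed[weakStarTopology (Fock ι)] (idealSpace J : Set (Fock ι →L[ℂ] Fock ι))) :
    (∀ I : Type*,
      ∃ Φ : (matrixSpace I (Subalgebra.toSubmodule (toeplitzAlgebra ι)) ⧸ matrixIdeal I J) →ₗᵢ[ℂ]
          (HilbertSum I (coRange J) →L[ℂ] HilbertSum I (coRange J)),
        ∀ (f : matrixSpace I (Subalgebra.toSubmodule (toeplitzAlgebra ι))) (α β : I),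
          entry (Φ (Submodule.Quotient.mk f)) α β =
            compression (coRange J) (entry f.1 α β)) ∧
    (∃ Φ : (toeplitzAlgebra ι ⧸ J) →ₐ[ℂ] (coRange J →L[ℂ] coRange J),
      (∀ f : toeplitzAlgebra ι,
        Φ (Ideal.Quotient.mk J f) = compression (coRange J) (f : Fock ι →L[ℂ] Fock ι)) ∧
      ∀ (k : ℕ) (x : Matrix (Fin k) (Fin k) (toeplitzAlgebra ι ⧸ J)),
        ‖ofMatrix fun i j => Φ (x i j)‖ = quotientMatrixNorm J x) := by
  refine ⟨fun I => ?_, ?_⟩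
  · let φ := (matrixCompression (coRange J) I).comp
      (matrixSpace I (Subalgebra.toSubmodule (toeplitzAlgebra ι))).subtype
    have hφ : matrixIdeal I J ≤ LinearMap.ker φ := fun f hf => matrixCompression_eq_zero hf
    refine ⟨⟨(matrixIdeal I J).liftQ φ hφ, fun q => ?_⟩, fun f α β =>
      entry_matrixCompression (coRange J) f.1 α β⟩
    obtain ⟨f, rfl⟩ := Submodule.Quotient.mk_surjective _ q
    exact (norm_mk_matrixIdeal hJ f).symm
  · let Φ : (toeplitzAlgebra ι ⧸ J) →ₐ[ℂ] (coRange J →L[ℂ] coRange J) :=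
      Ideal.Quotient.liftₐ J (compressionHom J) fun f hf =>
        compression_ideal ((mem_idealSpace J).2 ⟨f.2, hf⟩)
    have hΦ : ∀ f : toeplitzAlgebra ι,
        Φ (Ideal.Quotient.mk J f) = compression (coRange J) (f : Fock ι →L[ℂ] Fock ι) :=
      fun f => rfl
    refine ⟨Φ, hΦ, fun k x => ?_⟩
    have hrep : ∀ f : Matrix (Fin k) (Fin k) (toeplitzAlgebra ι),
        (∀ i j, Submodule.Quotient.mk (f i j) = x i j) →
        (ofMatrix fun i j => Φ (x i j)) = matrixCompression (coRange J) (Fin k)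
          (ofMatrix fun i j => (f i j : Fock ι →L[ℂ] Fock ι)) := fun f hf => by
      apply entry_injective
      funext i j
      rw [entry_matrixCompression, entry_ofMatrix, entry_ofMatrix, ← hf]
      exact hΦ (f i j)
    choose f hf using fun i j => Submodule.Quotient.mk_surjective J (x i j)
    obtain ⟨G, hG, hFG, hn⟩ := exists_representative hJ
      (F := ofMatrix fun i j => (f i j : Fock ι →L[ℂ] Fock ι)) (fun i j => by
        rw [entry_ofMatrix]
        exact (f i j).2)
    let g : Matrix (Fin k) (Fin k) (toeplitzAlgebra ι) := fun i j => ⟨entry G i j, hG i j⟩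
    have hgG : (ofMatrix fun i j => (g i j : Fock ι →L[ℂ] Fock ι)) = G := by
      apply entry_injective
      funext i j
      rw [entry_ofMatrix]
    have hg : ∀ i j, Submodule.Quotient.mk (g i j) = x i j := fun i j => by
      rw [← hf i j, eq_comm, Submodule.Quotient.eq]
      have h1 := hFG i j
      rw [entry_sub, entry_ofMatrix] at h1
      exact ((mem_idealSpace J).1 h1).2
    symm
    -- The lifted matrix attains the infimum, so no approximation is needed.
    refine IsLeast.csInf_eq ⟨⟨g, hg, ?_⟩, ?_⟩
    · refine le_antisymm ?_ ?_
      · rw [hrep g hg]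
        exact norm_matrixCompression_le _ _
      · rw [hgG, hrep f hf]
        exact hn
    · rintro _ ⟨f', hf', rfl⟩
      rw [hrep f' hf']
      exact norm_matrixCompression_le _ _
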